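/- Let $n\ge 1$, $0<\alpha<n$, $\beta\in(0,1)$. All functions $f$ are real- or complex-valued on $\mathbb R^n$; $B(x,r)$ is the open ball and $|E|$ is Lebesgue measure. **Definitions.** A Young function is a convex, left-continuous $\Phi:[0,\infty)\to[0,\infty]$ with $\lim_{r\to0+}\Phi(r)=\Phi(0)=0$ and $\lim_{r\to\infty}\Phi(r)=\infty$; we put $\Phi(\infty)=\infty$ and $\Phi^{-1}(s)=\inf\{r\ge0:\Phi(r)>s\}$ for $0\le s\le\infty$. We write $\Phi\in\Delta'$ if for some $C>1$, $\Phi(tr)\le C\Phi(t)\Phi(r)$ for all $t,r\ge0$ (with $0\cdot\infty=0$), and $\Phi\in\nabla_2$ if for some $C>1$, $\Phi(r)\le\frac1{2C}\Phi(Cr)$ for all $r\ge0$. Let $\|f\|_{L^\Phi}=\inf\{\lambda>0:\int_{\mathbb R^n}\Phi(|f(x)|/\lambda)\,dx\le1\}$. The space $L^\Phi(\mathbb R^n)$ is the set of $f\in L^1_{\rm loc}(\mathbb R^n)$ with $\int_{\mathbb R^n}\Phi(k|f|)\,dx<\infty$ for some $k>0$, and $f\in L^\Phi_{\rm loc}(\mathbb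 R^n)$ means that $f\chi_B\in L^\Phi(\mathbb R^n)$ for every ball $B$. For $\varphi:(0,\infty)\to(0,\infty)$ the generalized Orlicz–Morrey space $\mathcal M^{\Phi,\varphi}(\mathbb R^n)$ is the set of $f\in L^\Phi_{\rm loc}(\mathbb R^n)$ with $$\|f\|_{\mathcal M^{\Phi,\varphi}}=\sup_{x\in\mathbb R^n,\,r>0}\varphi(r)^{-1}\,\Phi^{-1}(|B(x,r)|^{-1})\,\|f\chi_{B(x,r)}\|_{L^\Phi}<\infty .$$ The same definitions apply to functions with values in $[0,\infty]$. We write $\varphi\in\Omega_\Phi$ if $\varphi$ is positive and measurable and, for every $t>0$, $$\sup_{x\in\mathbb R^n}\Big\|\frac{\Phi^{-1}(|B(x,r)|^{-1})}{\varphi(r)}\Big\|_{L^\infty_r(t,\infty)}<\infty,\qquad \big\|\varphi(r)^{-1}\big\|_{L^\infty_r(0,t)}<\infty .$$ We write $\varphi\in\mathcal G_\Phi$ if $\varphi:(0,\infty)\to(0,\infty)$ is almost decreasing (for some $C>0$, $\varphi(s)\le C\varphi(r)$ whenever $0<r\le s$) and $g(t)=\varphi(t)/\Phi^{-1}(t^{-n})$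 is almost increasing (for some $C>0$, $g(r)\le Cg(s)$ whenever $0<r\le s$). The fractional maximal function is $M_\alpha f(x)=\sup_{t>0}|B(x,t)|^{-1+\alpha/n}\int_{B(x,t)}|f(y)|\,dy$. It is bounded from $\mathcal M^{\Phi,\varphi}(\mathbb R^n)$ to $\mathcal M^{\Psi,\eta}(\mathbb R^n)$ if there is a constant $C$ such that, for all $f\in\mathcal M^{\Phi,\varphi}(\mathbb R^n)$, $M_\alpha f\in\mathcal M^{\Psi,\eta}(\mathbb R^n)$ and $\|M_\alpha f\|_{\mathcal M^{\Psi,\eta}}\le C\|f\|_{\mathcal M^{\Phi,\varphi}}$. **Theorem (Adams type result).** Let $\Phi$ be a Young function with $\Phi\in\Delta'$, let $\varphi\in\Omega_\Phi$, $\eta(t)=\varphi(t)^\beta$ and $\Psi(t)=\Phi(t^{1/\beta})$. 1. Suppose that $\Phi\in\nabla_2$ and that there is $C>0$ such that, for all $x\in\mathbb R^n$ and $r>0$, $$\sup_{r<t<\infty}\Phi^{-1}(|B(x,t)|^{-1})\operatorname*{ess\,inf}_{t<s<\infty}\frac{\varphi(s)}{\Phi^{-1}(|B(x,s)|^{-1})}\le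 C\varphi(r).$$ If there is $C>0$ such that $$t^\alpha\varphi(t)+\sup_{t<r<\infty}r^\alpha\varphi(r)\le C\varphi(t)^\beta\qquad\text{for all }t>0,$$ then $M_\alpha$ is bounded from $\mathcal M^{\Phi,\varphi}(\mathbb R^n)$ to $\mathcal M^{\Psi,\eta}(\mathbb R^n)$. 2. Suppose that $\varphi\in\mathcal G_\Phi$. If $M_\alpha$ is bounded from $\mathcal M^{\Phi,\varphi}(\mathbb R^n)$ to $\mathcal M^{\Psi,\eta}(\mathbb R^n)$, then there is $C>0$ such that $$t^\alpha\varphi(t)\le C\varphi(t)^\beta\qquad\text{for all }t>0.\tag{$*$}$$ 3. Suppose that $\Phi\in\nabla_2$ and $\varphi\in\mathcal G_\Phi$. Then $M_\alpha$ is bounded from $\mathcal M^{\Phi,\varphi}(\mathbb R^n)$ to $\mathcal M^{\Psi,\eta}(\mathbb R^n)$ if and only if there is $C>0$ such that $(*)$ holds. -/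

import Mathlib

open MeasureTheory Filter Topology Set
open scoped ENNReal NNReal

noncomputable section

namespace OrliczMorrey

/-- The Euclidean space `ℝⁿ`. -/
abbrev Rn (n : ℕ) := EuclideanSpace ℝ (Fin n)

/-- Young functions `Φ : [0,∞) → [0,∞]`. -/
structure IsYoung (Φ : ℝ≥0 → ℝ≥0∞) : Prop where
  convex : ConvexOn ℝ≥0 univ Φ
  leftCont : ∀ r : ℝ≥0, ContinuousWithinAt Φ (Iio r) r
  map_zero : Φ 0 = 0
  tendsto_zero : Tendsto Φ (𝓝[>] 0) (𝓝 0)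
  tendsto_top : Tendsto Φ atTop (𝓝 ∞)

/-- The generalized inverse `Φ⁻¹(s) = inf {r ≥ 0 : Φ(r) > s}`, for `0 ≤ s ≤ ∞` (with `inf ∅ = ∞`). -/
def youngInv (Φ : ℝ≥0 → ℝ≥0∞) (s : ℝ≥0∞) : ℝ≥0∞ :=
  ⨅ (r : ℝ≥0) (_ : s < Φ r), (r : ℝ≥0∞)

/-- The `∇₂`-condition. -/
def Nabla2 (Φ : ℝ≥0 → ℝ≥0∞) : Prop :=
  ∃ C : ℝ≥0, 1 < C ∧ ∀ r : ℝ≥0, Φ r ≤ (2 * (C : ℝ≥0∞))⁻¹ * Φ (C * r)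

/-- The `Δ'`-condition. -/
def DeltaPrime (Φ : ℝ≥0 → ℝ≥0∞) : Prop :=
  ∃ C : ℝ≥0, 1 < C ∧ ∀ t r : ℝ≥0, Φ (t * r) ≤ C * Φ t * Φ r

/-- The extension of `Φ` to `[0,∞]` by `Φ(∞) = ∞`; it lets `Φ` be applied to functions with values
in `[0,∞]`, such as maximal functions. -/
def youngExt (Φ : ℝ≥0 → ℝ≥0∞) (s : ℝ≥0∞) : ℝ≥0∞ :=
  if s = ∞ then ∞ else Φ s.toNNReal

section Spaces

variable {n : ℕ} {ε : Type*} [TopologicalSpace ε] [ENormedAddMonoid ε]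

/-- The Luxemburg norm `‖f‖_{L^Φ} = inf {c > 0 : ∫ Φ(|f(x)| / c) dx ≤ 1}`, with values in `[0,∞]`. -/
def orliczNorm (Φ : ℝ≥0 → ℝ≥0∞) (f : Rn n → ε) : ℝ≥0∞ :=
  ⨅ (c : ℝ≥0) (_ : 0 < c) (_ : ∫⁻ x, youngExt Φ (‖f x‖ₑ / c) ≤ 1), (c : ℝ≥0∞)

/-- Membership in the Orlicz space `L^Φ(ℝⁿ)`. -/
def MemOrlicz (Φ : ℝ≥0 → ℝ≥0∞) (f : Rn n → ε) : Prop :=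
  LocallyIntegrable f volume ∧ ∃ k : ℝ≥0, 0 < k ∧ ∫⁻ x, youngExt Φ (k * ‖f x‖ₑ) < ∞

/-- Membership in `L^Φ_loc(ℝⁿ)`. -/
def MemOrliczLoc (Φ : ℝ≥0 → ℝ≥0∞) (f : Rn n → ε) : Prop :=
  ∀ (x : Rn n) (r : ℝ), 0 < r → MemOrlicz Φ ((Metric.ball x r).indicator f)

/-- The norm of the generalized Orlicz-Morrey space `M^{Φ,φ}(ℝⁿ)`, with values in `[0,∞]`:
`sup_{x, r > 0} φ(x,r)⁻¹ Φ⁻¹(|B(x,r)|⁻¹) ‖f‖_{L^Φ(B(x,r))}`. -/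
def orliczMorreyNorm (Φ : ℝ≥0 → ℝ≥0∞) (φ : Rn n → ℝ → ℝ) (f : Rn n → ε) : ℝ≥0∞ :=
  ⨆ (x : Rn n) (r : ℝ) (_ : 0 < r),
    (ENNReal.ofReal (φ x r))⁻¹ * youngInv Φ (volume (Metric.ball x r))⁻¹ *
      orliczNorm Φ ((Metric.ball x r).indicator f)

/-- Membership in the generalized Orlicz-Morrey space `M^{Φ,φ}(ℝⁿ)`. -/
def MemOrliczMorrey (Φ : ℝ≥0 → ℝ≥0∞) (φ : Rn n → ℝ → ℝ) (f : Rn n → ε) : Prop :=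
  MemOrliczLoc Φ f ∧ orliczMorreyNorm Φ φ f < ∞

/-- The fractional maximal function
`M_α f(x) = sup_{t > 0} |B(x,t)|^{-1+α/n} ∫_{B(x,t)} |f(y)| dy`, with values in `[0,∞]`. -/
def fracMax (α : ℝ) (f : Rn n → ε) (x : Rn n) : ℝ≥0∞ :=
  ⨆ (t : ℝ) (_ : 0 < t),
    volume (Metric.ball x t) ^ (-1 + α / (n : ℝ)) * ∫⁻ y in Metric.ball x t, ‖f y‖ₑ

end Spaces

/-- Boundedness of `M_α` from `M^{Φ,φ}(ℝⁿ)` to `M^{Ψ,η}(ℝⁿ)`, on functions with values in `𝕜`. -/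
def FracMaxBounded (𝕜 : Type*) [RCLike 𝕜] {n : ℕ} (α : ℝ) (Φ : ℝ≥0 → ℝ≥0∞) (φ : Rn n → ℝ → ℝ)
    (Ψ : ℝ≥0 → ℝ≥0∞) (η : Rn n → ℝ → ℝ) : Prop :=
  ∃ C : ℝ≥0, ∀ f : Rn n → 𝕜, MemOrliczMorrey Φ φ f →
    MemOrliczMorrey Ψ η (fracMax α f) ∧
      orliczMorreyNorm Ψ η (fracMax α f) ≤ C * orliczMorreyNorm Φ φ f

/-- The class `Ω_Φ` of positive (Lebesgue) measurable functions on `ℝⁿ × (0,∞)`. Only the values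
`φ x r` with `r > 0` matter. -/
structure OmegaClass {n : ℕ} (Φ : ℝ≥0 → ℝ≥0∞) (φ : Rn n → ℝ → ℝ) : Prop where
  pos : ∀ (x : Rn n) (r : ℝ), 0 < r → 0 < φ x r
  meas : AEMeasurable (fun p : Rn n × ℝ => φ p.1 p.2) (volume.restrict (univ ×ˢ Ioi 0))
  bdd_infty : ∀ t : ℝ, 0 < t →
    ⨆ x : Rn n, essSup (fun r : ℝ =>
      youngInv Φ (volume (Metric.ball x r))⁻¹ / ENNReal.ofReal (φ x r))
        (volume.restrict (Ioi t)) < ∞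
  bdd_zero : ∀ t : ℝ, 0 < t →
    ⨆ x : Rn n, essSup (fun r : ℝ => (ENNReal.ofReal (φ x r))⁻¹) (volume.restrict (Ioo 0 t)) < ∞

/-- The maximal-operator condition: for some `C` and all `x` and `r > 0`,
`sup_{r<t<∞} Φ⁻¹(|B(x,t)|⁻¹) essinf_{t<s<∞} φ(x,s) / Φ⁻¹(|B(x,s)|⁻¹) ≤ C φ(x,r)`. -/
def MaximalCondition {n : ℕ} (Φ : ℝ≥0 → ℝ≥0∞) (φ : Rn n → ℝ → ℝ) : Prop :=
  ∃ C : ℝ≥0, ∀ (x : Rn n) (r : ℝ), 0 < r →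
    (⨆ (t : ℝ) (_ : r < t), youngInv Φ (volume (Metric.ball x t))⁻¹ *
      essInf (fun s : ℝ =>
        ENNReal.ofReal (φ x s) / youngInv Φ (volume (Metric.ball x s))⁻¹)
          (volume.restrict (Ioi t))) ≤ C * ENNReal.ofReal (φ x r)

/-- The class `G_Φ` of almost decreasing `φ : (0,∞) → (0,∞)` such that `t ↦ φ(t) / Φ⁻¹(t⁻ⁿ)` is
almost increasing. -/
structure GClass (n : ℕ) (Φ : ℝ≥0 → ℝ≥0∞) (φ : ℝ → ℝ) : Prop where
  pos : ∀ t : ℝ, 0 < t → 0 < φ t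
  almostDecreasing : ∃ C : ℝ, 0 < C ∧ ∀ r s : ℝ, 0 < r → r ≤ s → φ s ≤ C * φ r
  almostIncreasing : ∃ C : ℝ≥0, 0 < C ∧ ∀ r s : ℝ, 0 < r → r ≤ s →
    ENNReal.ofReal (φ r) / youngInv Φ (ENNReal.ofReal r ^ n)⁻¹ ≤
      C * (ENNReal.ofReal (φ s) / youngInv Φ (ENNReal.ofReal s ^ n)⁻¹)

end OrliczMorrey

end

namespace OrliczMorrey

/-! Sufficiency is Hedberg's argument. Let `N` be the Morrey norm of `u` and `w` its average over
`B(x,t)`. Then `w` is at most the Hardy–Littlewood maximal function `Mu(x)`, and also at most `2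
φ(t) N`, since averages are controlled by the Luxemburg norm (`IsYoung.average_ball_le`). Writing `w
= w^β w^(1-β)` and using one bound on each factor, `t^α w` is at most a constant times `t^α
φ(t)^(1-β) N^(1-β) (Mu(x))^β`. The growth condition says exactly that `t^α φ(t)^(1-β)` is bounded,
so `M_α u ≤ K N^(1-β) (Mu)^β` (`exists_fracMax_le`). Both bounds hold at every radius, so no
splitting into small and large radii is needed.

Since `Ψ(s^β) = Φ(s)`, `Ψ⁻¹ = (Φ⁻¹)^β` and `η = φ^β`, the target norm of `(Mu)^β` is at most the
`β`-th power of the `M^{Φ,φ}` norm of `Mu` (`orliczMorreyNorm_rpow_le`). It remains to bound `M` on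
`M^{Φ,φ}` (`exists_orliczMorreyNorm_hlMax_le`). On `B(x,r)` the part of `u` in `B(x,2r)` is handled
by a modular inequality, obtained from the weak type (1,1) bound and `∇₂` by summing over geometric
levels. Averages over radii above `r` are bounded by a constant, through the maximal condition.

Necessity tests the operator on the indicator of `B = B(0,t)`: its norm is at most a constant over
`φ(t)` because `φ` is in `G_Φ`, while `M_α` of it is at least `c t^α` on `B`. For the equivalence,
`G_Φ` itself implies the maximal condition (`GClass.maximalCondition`). -/

theorem ennreal_div_mul {s a b : ℝ≥0∞} (ha : a ≠ 0) (ha' : a ≠ ∞) :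
    s / (a * b) = s / a / b := by
  rw [div_eq_mul_inv, ENNReal.mul_inv (Or.inl ha) (Or.inl ha'), ← mul_assoc]
  rfl

/-! ### Young functions and their generalized inverses. -/

section Young

variable {Φ : ℝ≥0 → ℝ≥0∞}

theorem IsYoung.map_mul_le (hΦ : IsYoung Φ) {θ : ℝ≥0} (hθ : θ ≤ 1) (r : ℝ≥0) :
    Φ (θ * r) ≤ θ * Φ r := by
  have h := hΦ.convex.2 (mem_univ r) (mem_univ 0) (zero_le (a := θ)) (zero_le (a := 1 - θ))
    (add_tsub_cancel_of_le hθ)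
  simpa [hΦ.map_zero, ENNReal.smul_def] using h

theorem IsYoung.mul_le_map (hΦ : IsYoung Φ) {K : ℝ≥0} (hK : 1 ≤ K) (r : ℝ≥0) :
    K * Φ r ≤ Φ (K * r) := by
  have hK0 : K ≠ 0 := (zero_lt_one.trans_le hK).ne'
  have h := hΦ.map_mul_le (inv_le_one_of_one_le₀ hK) (K * r)
  rw [inv_mul_cancel_left₀ hK0] at h
  calc K * Φ r ≤ K * ((K⁻¹ : ℝ≥0) * Φ (K * r)) := by gcongr
    _ = Φ (K * r) := by
      rw [← mul_assoc, ← ENNReal.coe_mul, mul_inv_cancel₀ hK0, ENNReal.coe_one, one_mul]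

theorem IsYoung.monotone (hΦ : IsYoung Φ) : Monotone Φ := by
  intro a b hab
  rcases eq_or_ne b 0 with rfl | hb
  · rw [nonpos_iff_eq_zero.1 hab]
  · have hθ : a / b ≤ 1 := div_le_one_of_le₀ hab zero_le
    calc Φ a = Φ (a / b * b) := by rw [div_mul_cancel₀ _ hb]
      _ ≤ (a / b : ℝ≥0) * Φ b := hΦ.map_mul_le hθ b
      _ ≤ 1 * Φ b := by gcongr; exact_mod_cast hθ
      _ = Φ b := one_mul _

@[simp] theorem youngExt_top (Φ : ℝ≥0 → ℝ≥0∞) : youngExt Φ ∞ = ∞ := by simp [youngExt]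

@[simp] theorem youngExt_coe (Φ : ℝ≥0 → ℝ≥0∞) (r : ℝ≥0) : youngExt Φ r = Φ r := by
  simp [youngExt]

theorem monotone_youngExt (hΦ : Monotone Φ) : Monotone (youngExt Φ) := by
  intro a b hab
  induction b using ENNReal.recTopCoe with
  | top => simp
  | coe b =>
    lift a to ℝ≥0 using ne_top_of_le_ne_top ENNReal.coe_ne_top hab
    simpa using hΦ (ENNReal.coe_le_coe.1 hab)

theorem measurable_youngExt (hΦ : Monotone Φ) : Measurable (youngExt Φ) :=
  (monotone_youngExt hΦ).measurable

theorem IsYoung.youngExt_zero (hΦ : IsYoung Φ) : youngExt Φ 0 = 0 := by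
  simpa [hΦ.map_zero] using youngExt_coe Φ 0

theorem IsYoung.youngExt_half_le (hΦ : IsYoung Φ) (s : ℝ≥0∞) :
    youngExt Φ (s / 2) ≤ youngExt Φ s / 2 := by
  induction s using ENNReal.recTopCoe with
  | top => simp [ENNReal.top_div]
  | coe s =>
    have h := hΦ.map_mul_le (θ := 2⁻¹) (by norm_num [inv_le_one₀]) s
    rw [ENNReal.div_eq_inv_mul, ENNReal.div_eq_inv_mul, youngExt_coe]
    have : ((2 : ℝ≥0∞))⁻¹ = ((2⁻¹ : ℝ≥0) : ℝ≥0∞) := by simp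
    rw [this, ← ENNReal.coe_mul, youngExt_coe]
    exact h

theorem le_youngInv (hΦ : Monotone Φ) {r : ℝ≥0} {s : ℝ≥0∞} (h : Φ r ≤ s) :
    (r : ℝ≥0∞) ≤ youngInv Φ s :=
  le_iInf₂ fun q hq => by
    by_contra! hlt
    exact (hq.trans_le (hΦ (ENNReal.coe_lt_coe.1 hlt).le)).not_ge h

theorem youngInv_le {r : ℝ≥0} {s : ℝ≥0∞} (h : s < Φ r) : youngInv Φ s ≤ r :=
  iInf₂_le r h

theorem map_le_of_lt_youngInv {r : ℝ≥0} {s : ℝ≥0∞} (h : (r : ℝ≥0∞) < youngInv Φ s) : Φ r ≤ s := by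
  by_contra! hlt
  exact (youngInv_le hlt).not_gt h

theorem youngInv_mono : Monotone (youngInv Φ) := fun _ _ hst =>
  le_iInf₂ fun _ hr => youngInv_le (hst.trans_lt hr)

theorem IsYoung.youngInv_pos (hΦ : IsYoung Φ) {s : ℝ≥0∞} (hs : 0 < s) : 0 < youngInv Φ s := by
  have h := (hΦ.tendsto_zero.eventually (gt_mem_nhds hs)).and self_mem_nhdsWithin
  obtain ⟨r, hr, hr0⟩ := h.exists
  exact lt_of_lt_of_le (ENNReal.coe_pos.2 hr0) (le_youngInv hΦ.monotone hr.le)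

theorem IsYoung.youngInv_lt_top (hΦ : IsYoung Φ) {s : ℝ≥0∞} (hs : s < ∞) : youngInv Φ s < ∞ := by
  obtain ⟨r, hr⟩ := (hΦ.tendsto_top.eventually (lt_mem_nhds hs)).exists
  exact (youngInv_le hr).trans_lt ENNReal.coe_lt_top

/-- Convexity gives `K Φ(r) ≤ Φ(K r)`. This is the source of every doubling property of `r ↦
Φ⁻¹(|B(x,r)|⁻¹)` below. -/
theorem IsYoung.youngInv_mul_le (hΦ : IsYoung Φ) {K : ℝ≥0} (hK : 1 ≤ K) (s : ℝ≥0∞) :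
    youngInv Φ (K * s) ≤ K * youngInv Φ s := by
  have hK0 : (K : ℝ≥0∞) ≠ 0 := ENNReal.coe_ne_zero.2 (zero_lt_one.trans_le hK).ne'
  rw [mul_comm (K : ℝ≥0∞) (youngInv Φ s), ← ENNReal.div_le_iff hK0 ENNReal.coe_ne_top]
  refine le_iInf₂ fun r hr => ?_
  rw [ENNReal.div_le_iff hK0 ENNReal.coe_ne_top, mul_comm (r : ℝ≥0∞), ← ENNReal.coe_mul]
  refine youngInv_le (lt_of_lt_of_le ?_ (hΦ.mul_le_map hK r))
  exact ENNReal.mul_lt_mul_right hK0 ENNReal.coe_ne_top hr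

/-- Either `u ≤ r`, or convexity gives `Φ(u) ≥ (u/r) Φ(r)`. This replaces Hölder's inequality, so
that no complementary Young function is needed. -/
theorem IsYoung.le_add_mul_youngExt (hΦ : IsYoung Φ) {r : ℝ≥0} {s : ℝ≥0∞} (hs : s < Φ r)
    (u : ℝ≥0∞) : u * s ≤ r * s + r * youngExt Φ u := by
  have hr0 : r ≠ 0 := by
    rintro rfl
    simp [hΦ.map_zero] at hs
  induction u using ENNReal.recTopCoe with
  | top => simp [hr0]
  | coe u =>
    rcases le_total u r with hur | hru
    · exact le_add_right (by gcongr)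
    · refine le_add_left ?_
      have h := hΦ.mul_le_map (K := u / r) ((one_le_div₀ (pos_iff_ne_zero.2 hr0)).2 hru) r
      rw [div_mul_cancel₀ _ hr0] at h
      calc (u : ℝ≥0∞) * s ≤ u * Φ r := by gcongr
        _ = r * ((u / r : ℝ≥0) * Φ r) := by
          rw [← mul_assoc, ← ENNReal.coe_mul, mul_div_cancel₀ _ hr0]
        _ ≤ r * youngExt Φ u := by rw [youngExt_coe]; gcongr

end Young

/-! ### The substitution `Ψ(t) = Φ(t^(1/β))`. -/

section Power

variable {Φ Ψ : ℝ≥0 → ℝ≥0∞} {β : ℝ}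

theorem youngExt_rpow (hβ : 0 < β) (hΨ : ∀ t : ℝ≥0, Ψ t = Φ (t ^ (1 / β))) (s : ℝ≥0∞) :
    youngExt Ψ (s ^ β) = youngExt Φ s := by
  induction s using ENNReal.recTopCoe with
  | top => simp [ENNReal.top_rpow_of_pos hβ]
  | coe s =>
    rw [← ENNReal.coe_rpow_of_nonneg _ hβ.le, youngExt_coe, youngExt_coe, hΨ, ← NNReal.rpow_mul,
      mul_one_div_cancel hβ.ne', NNReal.rpow_one]

theorem youngInv_of_rpow (hβ : 0 < β) (hΨ : ∀ t : ℝ≥0, Ψ t = Φ (t ^ (1 / β))) (s : ℝ≥0∞) :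
    youngInv Ψ s = youngInv Φ s ^ β := by
  apply le_antisymm
  · rw [← ENNReal.rpow_inv_le_iff hβ]
    refine le_iInf₂ fun r hr => ?_
    rw [ENNReal.rpow_inv_le_iff hβ, ← ENNReal.coe_rpow_of_nonneg _ hβ.le]
    refine youngInv_le ?_
    rwa [hΨ, ← NNReal.rpow_mul, mul_one_div_cancel hβ.ne', NNReal.rpow_one]
  · refine le_iInf₂ fun r hr => ?_
    rw [hΨ] at hr
    rw [← ENNReal.le_rpow_inv_iff hβ, ← one_div,
      ← ENNReal.coe_rpow_of_nonneg _ (one_div_pos.2 hβ).le]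
    exact youngInv_le hr

theorem monotone_of_rpow (hβ : 0 < β) (hΨ : ∀ t : ℝ≥0, Ψ t = Φ (t ^ (1 / β)))
    (hΦ : Monotone Φ) : Monotone Ψ := by
  intro a b hab
  rw [hΨ, hΨ]
  exact hΦ (NNReal.rpow_le_rpow hab (one_div_pos.2 hβ).le)

end Power

/-! ### Luxemburg norms. -/

section Luxemburg

variable {n : ℕ} {ε : Type*} [TopologicalSpace ε] [ENormedAddMonoid ε] {Φ Ψ : ℝ≥0 → ℝ≥0∞}

theorem orliczNorm_le {f : Rn n → ε} {c : ℝ≥0} (hc : 0 < c)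
    (h : ∫⁻ x, youngExt Φ (‖f x‖ₑ / c) ≤ 1) : orliczNorm Φ f ≤ c :=
  iInf_le_of_le c (iInf_le_of_le hc (iInf_le _ h))

theorem le_orliczNorm {f : Rn n → ε} {a : ℝ≥0∞}
    (h : ∀ c : ℝ≥0, 0 < c → ∫⁻ x, youngExt Φ (‖f x‖ₑ / c) ≤ 1 → a ≤ c) : a ≤ orliczNorm Φ f :=
  le_iInf fun c => le_iInf fun hc => le_iInf fun h' => h c hc h'

theorem exists_of_orliczNorm_lt {f : Rn n → ε} {a : ℝ≥0∞} (h : orliczNorm Φ f < a) :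
    ∃ c : ℝ≥0, 0 < c ∧ ∫⁻ x, youngExt Φ (‖f x‖ₑ / c) ≤ 1 ∧ (c : ℝ≥0∞) < a := by
  simpa only [orliczNorm, iInf_lt_iff, exists_prop] using h

theorem orliczNorm_mono {ε' : Type*} [TopologicalSpace ε'] [ENormedAddMonoid ε']
    (hΦ : Monotone Φ) {f : Rn n → ε} {g : Rn n → ε'}
    (h : ∀ x, ‖f x‖ₑ ≤ ‖g x‖ₑ) : orliczNorm Φ f ≤ orliczNorm Φ g :=
  le_orliczNorm fun _ hc hg => orliczNorm_le hc <| le_trans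
    (lintegral_mono fun x => monotone_youngExt hΦ (ENNReal.div_le_div_right (h x) _)) hg

theorem orliczNorm_const_mul_le (hΦ0 : youngExt Φ 0 = 0) (u : Rn n → ℝ≥0∞) (a : ℝ≥0) :
    orliczNorm Φ (fun x => a * u x) ≤ a * orliczNorm Φ u := by
  rcases eq_or_ne a 0 with rfl | ha
  -- For the zero function every positive `c` is admissible, but the infimum `0` is not attained.
  · refine le_trans (le_of_forall_pos_lt_add' ?_) zero_le
    intro b hb
    obtain ⟨c, hc0, hc⟩ := ENNReal.lt_iff_exists_nnreal_btwn.1 hb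
    rw [zero_add]
    refine (orliczNorm_le (ENNReal.coe_pos.1 hc0) ?_).trans_lt hc
    simp [hΦ0]
  · have ha' : (a : ℝ≥0∞) ≠ 0 := ENNReal.coe_ne_zero.2 ha
    rw [mul_comm, ← ENNReal.div_le_iff ha' ENNReal.coe_ne_top]
    refine le_orliczNorm fun c hc h => ?_
    rw [ENNReal.div_le_iff ha' ENNReal.coe_ne_top, ← ENNReal.coe_mul]
    refine orliczNorm_le (by positivity) (le_of_eq_of_le (lintegral_congr fun x => ?_) h)
    simp only [enorm_eq_self]
    rw [ENNReal.coe_mul, mul_comm (c : ℝ≥0∞),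
      ENNReal.mul_div_mul_left _ _ ha' ENNReal.coe_ne_top]

theorem orliczNorm_rpow_le {β : ℝ} (hβ : 0 < β) (hΨ : ∀ t : ℝ≥0, Ψ t = Φ (t ^ (1 / β)))
    (u : Rn n → ℝ≥0∞) : orliczNorm Ψ (fun x => u x ^ β) ≤ orliczNorm Φ u ^ β := by
  rw [← ENNReal.rpow_inv_le_iff hβ]
  refine le_orliczNorm fun c hc h => ?_
  rw [ENNReal.rpow_inv_le_iff hβ, ← ENNReal.coe_rpow_of_nonneg _ hβ.le]
  refine orliczNorm_le (NNReal.rpow_pos hc) (le_of_eq_of_le (lintegral_congr fun x => ?_) h)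
  simp only [enorm_eq_self]
  rw [ENNReal.coe_rpow_of_nonneg _ hβ.le, ← ENNReal.div_rpow_of_nonneg _ _ hβ.le,
    youngExt_rpow hβ hΨ]

/-- Convexity halves the modular when the argument is halved; this absorbs the sum of two modulars,
each at most `1`. Only `w` must be measurable, to split the integral of the sum. -/
theorem IsYoung.orliczNorm_le_two_mul_max (hΦ : IsYoung Φ) {u v w : Rn n → ℝ≥0∞}
    (hw : AEMeasurable w) (h : ∀ x, u x ≤ max (v x) (w x)) :
    orliczNorm Φ u ≤ 2 * max (orliczNorm Φ v) (orliczNorm Φ w) := by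
  refine le_of_forall_gt fun a ha => ?_
  have ha2 : max (orliczNorm Φ v) (orliczNorm Φ w) < a / 2 := by
    rw [ENNReal.lt_div_iff_mul_lt (by simp) (by simp), mul_comm]
    exact ha
  obtain ⟨b, hb, hv, hba⟩ := exists_of_orliczNorm_lt ((le_max_left _ _).trans_lt ha2)
  obtain ⟨c, hc, hw', hca⟩ := exists_of_orliczNorm_lt ((le_max_right _ _).trans_lt ha2)
  have hm : ((max b c : ℝ≥0) : ℝ≥0∞) < a / 2 := by
    rcases max_choice b c with h | h <;> rwa [h]
  have hm0 : 0 < max b c := lt_max_of_lt_left hb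
  refine lt_of_le_of_lt (orliczNorm_le (c := 2 * max b c) (by positivity) ?_) ?_
  · have key : ∀ x, youngExt Φ (‖u x‖ₑ / (2 * max b c : ℝ≥0)) ≤
        (youngExt Φ (‖v x‖ₑ / b) + youngExt Φ (‖w x‖ₑ / c)) / 2 := by
      intro x
      have h1 : ‖u x‖ₑ / (2 * max b c : ℝ≥0) ≤ max (‖v x‖ₑ / b) (‖w x‖ₑ / c) / 2 := by
        rw [ENNReal.coe_mul, mul_comm ((2 : ℝ≥0) : ℝ≥0∞), ENNReal.coe_ofNat,
          ennreal_div_mul (ENNReal.coe_ne_zero.2 hm0.ne') ENNReal.coe_ne_top]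
        refine ENNReal.div_le_div_right ?_ _
        simp only [enorm_eq_self]
        refine (ENNReal.div_le_div_right (h x) _).trans ?_
        rw [(show Monotone fun s : ℝ≥0∞ => s / (max b c : ℝ≥0) from
          fun _ _ h => ENNReal.div_le_div_right h _).map_max]
        refine max_le_max (ENNReal.div_le_div_left ?_ _) (ENNReal.div_le_div_left ?_ _)
        · exact_mod_cast le_max_left b c
        · exact_mod_cast le_max_right b c
      refine (monotone_youngExt hΦ.monotone h1).trans ((hΦ.youngExt_half_le _).trans ?_)
      refine ENNReal.div_le_div_right ?_ _
      rw [(monotone_youngExt hΦ.monotone).map_max]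
      exact max_le_add_of_nonneg zero_le zero_le
    refine (lintegral_mono key).trans ?_
    simp only [ENNReal.div_eq_inv_mul]
    rw [lintegral_const_mul' _ _ (by simp), lintegral_add_right']
    · rw [← ENNReal.div_eq_inv_mul]
      refine ENNReal.div_le_of_le_mul ?_
      simp only [ENNReal.div_eq_inv_mul] at hv hw'
      rw [one_mul]
      exact (add_le_add hv hw').trans_eq one_add_one_eq_two
    · refine (measurable_youngExt hΦ.monotone).comp_aemeasurable ?_
      simp only [enorm_eq_self]
      exact hw.const_mul _
  · rw [ENNReal.lt_div_iff_mul_lt (by simp) (by simp)] at hm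
    rwa [ENNReal.coe_mul, mul_comm]

theorem orliczNorm_le_of_modular {u v : Rn n → ℝ≥0∞} {K : ℝ≥0}
    (hK : 0 < K) (h : ∀ c : ℝ≥0, 0 < c →
      ∫⁻ x, youngExt Φ (v x / c / K) ≤ ∫⁻ x, youngExt Φ (u x / c)) :
    orliczNorm Φ v ≤ K * orliczNorm Φ u := by
  have hK' : (K : ℝ≥0∞) ≠ 0 := ENNReal.coe_ne_zero.2 hK.ne'
  rw [mul_comm, ← ENNReal.div_le_iff hK' ENNReal.coe_ne_top]
  refine le_orliczNorm fun c hc hu => ?_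
  rw [ENNReal.div_le_iff hK' ENNReal.coe_ne_top, ← ENNReal.coe_mul]
  refine orliczNorm_le (by positivity) ?_
  refine le_trans (le_of_eq (lintegral_congr fun x => ?_)) ((h c hc).trans hu)
  have hc' : (c : ℝ≥0∞) ≠ 0 := ENNReal.coe_ne_zero.2 hc.ne'
  rw [enorm_eq_self, ENNReal.coe_mul, ennreal_div_mul hc' ENNReal.coe_ne_top]

end Luxemburg

/-! ### The Hardy–Littlewood maximal function: measurability and weak type bounds. -/

section Maximal

variable {n : ℕ}

/-- The centred Hardy–Littlewood maximal function of a function with values in `[0,∞]`. -/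
noncomputable def hlMax (u : Rn n → ℝ≥0∞) (x : Rn n) : ℝ≥0∞ :=
  ⨆ (t : ℝ) (_ : 0 < t), (volume (Metric.ball x t))⁻¹ * ∫⁻ y in Metric.ball x t, u y

theorem volume_ball_pos (x : Rn n) {r : ℝ} (hr : 0 < r) : 0 < volume (Metric.ball x r) :=
  Metric.measure_ball_pos _ _ hr

theorem volume_ball_ne_top (x : Rn n) (r : ℝ) : volume (Metric.ball x r) ≠ ∞ :=
  measure_ball_lt_top.ne

theorem volume_ball_mul (x y : Rn n) {r : ℝ} (c : ℝ) (hr : 0 < r) :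
    volume (Metric.ball x (r * c)) = ENNReal.ofReal r ^ n * volume (Metric.ball y c) := by
  rw [Measure.addHaar_ball_mul_of_pos _ _ hr, finrank_euclideanSpace_fin,
    ENNReal.ofReal_pow hr.le, ← Measure.addHaar_ball_center volume y c]

theorem volume_ball_eq (x y : Rn n) (r : ℝ) :
    volume (Metric.ball x r) = volume (Metric.ball y r) := by
  rw [Measure.addHaar_ball_center volume x, Measure.addHaar_ball_center volume y]

theorem inv_volume_ball_le (x y : Rn n) (r : ℝ) :
    (volume (Metric.ball x r))⁻¹ = (2 ^ n : ℝ≥0) * (volume (Metric.ball y (2 * r)))⁻¹ := by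
  rw [volume_ball_mul y x r two_pos, ENNReal.mul_inv (by simp) (by simp), ← mul_assoc]
  simp [ENNReal.mul_inv_cancel]

/-- A ball is the increasing union of slightly smaller concentric balls, each contained in the balls
of the original radius about nearby centres. No measurability of `u` is required, because
`withDensity` is a measure in any case. -/
theorem lowerSemicontinuous_setLIntegral_ball (u : Rn n → ℝ≥0∞) (t : ℝ) :
    LowerSemicontinuous fun x => ∫⁻ y in Metric.ball x t, u y := by
  intro x a ha
  change a < ∫⁻ y in Metric.ball x t, u y at ha
  have hU : Metric.ball x t = ⋃ k : ℕ, Metric.ball x (t - 1 / (k + 1)) := by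
    ext y
    simp only [Metric.mem_ball, mem_iUnion]
    refine ⟨fun h => ?_, fun ⟨k, hk⟩ => hk.trans (sub_lt_self _ (by positivity))⟩
    obtain ⟨k, hk⟩ := exists_nat_one_div_lt (sub_pos.2 h)
    exact ⟨k, by linarith⟩
  have hmono : Monotone fun k : ℕ => Metric.ball x (t - 1 / ((k : ℝ) + 1)) := fun k l hkl =>
    Metric.ball_subset_ball (sub_le_sub_left (by gcongr) _)
  rw [hU, ← withDensity_apply _ (MeasurableSet.iUnion fun _ => Metric.isOpen_ball.measurableSet),
    hmono.measure_iUnion, lt_iSup_iff] at ha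
  obtain ⟨k, hk⟩ := ha
  rw [withDensity_apply _ Metric.isOpen_ball.measurableSet] at hk
  filter_upwards [Metric.ball_mem_nhds x (ε := 1 / ((k : ℝ) + 1)) (by positivity)] with y hy
  refine hk.trans_le (lintegral_mono_set (Metric.ball_subset_ball' ?_))
  rw [dist_comm]
  linarith [Metric.mem_ball.1 hy]

theorem lowerSemicontinuous_iSup_ball (c : ℝ → ℝ≥0∞) (u : Rn n → ℝ≥0∞) :
    LowerSemicontinuous fun x => ⨆ (t : ℝ) (_ : 0 < t), c t * ∫⁻ y in Metric.ball x t, u y := by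
  refine lowerSemicontinuous_biSup fun t _ => ?_
  intro x a ha
  rcases eq_or_ne (c t) 0 with h0 | h0
  · simp [h0] at ha
  rcases eq_or_ne (c t) ∞ with hT | hT
  · have hx : 0 < ∫⁻ y in Metric.ball x t, u y := by
      rw [pos_iff_ne_zero]
      intro h
      simp [h] at ha
    filter_upwards [lowerSemicontinuous_setLIntegral_ball u t x 0 hx] with y hy
    rw [hT, ENNReal.top_mul hy.ne']
    exact ha.trans_le le_top
  · have hx : a / c t < ∫⁻ y in Metric.ball x t, u y := by
      rwa [ENNReal.div_lt_iff (Or.inl h0) (Or.inl hT), mul_comm]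
    filter_upwards [lowerSemicontinuous_setLIntegral_ball u t x _ hx] with y hy
    exact mul_comm (c t) _ ▸ (ENNReal.div_lt_iff (Or.inl h0) (Or.inl hT)).1 hy

theorem measurable_hlMax (u : Rn n → ℝ≥0∞) : Measurable (hlMax u) := by
  have h := lowerSemicontinuous_iSup_ball (fun t => (volume (Metric.ball (0 : Rn n) t))⁻¹) u
  have heq : hlMax u = fun x => ⨆ (t : ℝ) (_ : 0 < t),
      (volume (Metric.ball (0 : Rn n) t))⁻¹ * ∫⁻ y in Metric.ball x t, u y := by
    funext x
    simp only [hlMax, volume_ball_eq x 0]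
  rw [heq]
  exact h.measurable

theorem le_hlMax (u : Rn n → ℝ≥0∞) (x : Rn n) {t : ℝ} (ht : 0 < t) :
    (volume (Metric.ball x t))⁻¹ * ∫⁻ y in Metric.ball x t, u y ≤ hlMax u x :=
  le_iSup₂ (f := fun t (_ : 0 < t) => (volume (Metric.ball x t))⁻¹ *
    ∫⁻ y in Metric.ball x t, u y) t ht

theorem hlMax_le_add {u v : Rn n → ℝ≥0∞} {c : ℝ≥0∞} (h : ∀ x, u x ≤ v x + c) (x : Rn n) :
    hlMax u x ≤ hlMax v x + c := by
  refine iSup₂_le fun t ht => ?_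
  calc (volume (Metric.ball x t))⁻¹ * ∫⁻ y in Metric.ball x t, u y
      ≤ (volume (Metric.ball x t))⁻¹ * ∫⁻ y in Metric.ball x t, (v y + c) := by
        gcongr with y; exact h y
    _ = (volume (Metric.ball x t))⁻¹ * (∫⁻ y in Metric.ball x t, v y) + c := by
        rw [lintegral_add_right _ measurable_const, setLIntegral_const, mul_add, mul_comm c,
          ← mul_assoc, ENNReal.inv_mul_cancel (volume_ball_pos x ht).ne' (volume_ball_ne_top x t),
          one_mul]
    _ ≤ hlMax v x + c := by gcongr; exact le_hlMax v x ht

theorem hlMax_div (u : Rn n → ℝ≥0∞) {c : ℝ≥0} (hc : 0 < c) (x : Rn n) :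
    hlMax (fun y => u y / c) x = hlMax u x / c := by
  have hc' : ((c : ℝ≥0∞))⁻¹ ≠ ∞ := by simpa using hc.ne'
  simp only [hlMax, div_eq_mul_inv, ENNReal.iSup_mul, lintegral_mul_const' _ _ hc', mul_assoc]

/-- The weak type `(1,1)` bound for the Hardy–Littlewood maximal function. -/
theorem mul_volume_lt_hlMax_le (hn : n ≠ 0) (u : Rn n → ℝ≥0∞) {a : ℝ≥0} (ha : 0 < a) :
    a * volume {x | (a : ℝ≥0∞) < hlMax u x} ≤ 5 ^ n * ∫⁻ x, u x := by
  rcases eq_or_ne (∫⁻ x, u x) ∞ with hI | hI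
  · rw [hI, ENNReal.mul_top (by simp)]
    exact le_top
  set S := {x | (a : ℝ≥0∞) < hlMax u x} with hS
  have ha' : (a : ℝ≥0∞) ≠ 0 := ENNReal.coe_ne_zero.2 ha.ne'
  have hex : ∀ x ∈ S, ∃ t : ℝ, 0 < t ∧
      a * volume (Metric.ball x t) ≤ ∫⁻ y in Metric.ball x t, u y := by
    intro x hx
    obtain ⟨t, h⟩ := lt_iSup_iff.1 (show (a : ℝ≥0∞) < hlMax u x from hx)
    obtain ⟨ht, h⟩ := lt_iSup_iff.1 h
    refine ⟨t, ht, ?_⟩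
    rw [← ENNReal.div_eq_inv_mul, ENNReal.lt_div_iff_mul_lt
      (Or.inl (volume_ball_pos x ht).ne') (Or.inl (volume_ball_ne_top x t))] at h
    exact h.le
  choose! ρ hρ0 hρ using hex
  have hv0 := (volume_ball_pos (0 : Rn n) one_pos).ne'
  set V := volume (Metric.ball (0 : Rn n) 1) with hV
  have hav : (a : ℝ≥0∞) * V ≠ 0 := mul_ne_zero ha' hv0
  -- Vitali's lemma needs bounded radii. Here `a |B(0,1)| ρ^n ≤ ∫ u < ∞`, and `ρ ≤ ρ^n` once `ρ ≥
  -- 1`, as `n ≠ 0`.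
  have hR : ∀ x ∈ S, ρ x ≤ max 1 ((∫⁻ x, u x) / (a * V)).toReal := by
    intro x hx
    rcases le_total (ρ x) 1 with h1 | h1
    · exact le_max_of_le_left h1
    refine le_max_of_le_right ((le_self_pow₀ h1 hn).trans ?_)
    refine (ENNReal.ofReal_le_iff_le_toReal (ENNReal.div_ne_top hI hav)).1 ?_
    rw [ENNReal.le_div_iff_mul_le (Or.inl hav)
      (Or.inl (ENNReal.mul_ne_top ENNReal.coe_ne_top (volume_ball_ne_top _ _))),
      ENNReal.ofReal_pow (hρ0 x hx).le]
    have h := (hρ x hx).trans (setLIntegral_le_lintegral _ _)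
    rw [← mul_one (ρ x), volume_ball_mul x 0 1 (hρ0 x hx)] at h
    rwa [mul_left_comm] at h
  obtain ⟨T, hTS, hdisj, hcov⟩ :=
    Vitali.exists_disjoint_subfamily_covering_enlargement_closedBall S id ρ _ hR 5 (by norm_num)
  have hTc : T.Countable := hdisj.countable_of_nonempty_interior fun x hx =>
    ⟨x, Metric.ball_subset_interior_closedBall (Metric.mem_ball_self (hρ0 x (hTS hx)))⟩
  have hdisj' : T.PairwiseDisjoint fun x => Metric.ball x (ρ x) :=
    hdisj.mono fun x => Metric.ball_subset_closedBall
  have hSsub : S ⊆ ⋃ x ∈ T, Metric.closedBall x (5 * ρ x) := by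
    intro x hx
    obtain ⟨y, hy, hxy⟩ := hcov x hx
    exact mem_biUnion hy (hxy (Metric.mem_closedBall_self (hρ0 x hx).le))
  -- Makes the space nontrivial, so that open and closed balls have equal measure.
  have : Nonempty (Fin n) := ⟨⟨0, Nat.pos_of_ne_zero hn⟩⟩
  have : Countable T := hTc
  calc (a : ℝ≥0∞) * volume S
      ≤ a * ∑' x : T, volume (Metric.closedBall (x : Rn n) (5 * ρ x)) := by
        gcongr
        exact (measure_mono hSsub).trans (measure_biUnion_le _ hTc _)
    _ = ∑' x : T, 5 ^ n * (a * volume (Metric.ball (x : Rn n) (ρ x))) := by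
        rw [← ENNReal.tsum_mul_left]
        refine tsum_congr fun x => ?_
        rw [Measure.addHaar_closedBall_eq_addHaar_ball,
          volume_ball_mul (x : Rn n) x (ρ x) (by norm_num : (0 : ℝ) < 5), mul_left_comm]
        simp
    _ ≤ ∑' x : T, 5 ^ n * ∫⁻ y in Metric.ball (x : Rn n) (ρ x), u y := by
        gcongr with x
        exact hρ x (hTS x.2)
    _ = 5 ^ n * ∫⁻ y in ⋃ x ∈ T, Metric.ball x (ρ x), u y := by
        rw [ENNReal.tsum_mul_left, lintegral_biUnion hTc
          (fun x _ => Metric.isOpen_ball.measurableSet) hdisj']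
    _ ≤ 5 ^ n * ∫⁻ x, u x := mul_le_mul' le_rfl (setLIntegral_le_lintegral _ _)

/-- Since `u ≤ u 1_{u > a} + a`, the set where `Mu > 2a` lies in the set where the maximal function
of the truncation exceeds `a`. -/
theorem mul_volume_lt_hlMax_le_indicator (hn : n ≠ 0) (u : Rn n → ℝ≥0∞) {a : ℝ≥0} (ha : 0 < a) :
    a * volume {x | (2 * a : ℝ≥0∞) < hlMax u x} ≤
      5 ^ n * ∫⁻ x, (Ioi (a : ℝ≥0∞)).indicator id (u x) := by
  refine le_trans ?_ (mul_volume_lt_hlMax_le hn _ ha)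
  refine mul_le_mul' le_rfl (measure_mono fun x hx => ?_)
  have h := hlMax_le_add (u := u) (v := fun y => (Ioi (a : ℝ≥0∞)).indicator id (u y)) (c := a)
    (fun y => ?_) x
  · have h2 := (show (2 * a : ℝ≥0∞) < hlMax u x from hx).trans_le h
    rw [two_mul] at h2
    exact lt_of_add_lt_add_right h2
  · by_cases hy : (a : ℝ≥0∞) < u y
    · rw [indicator_of_mem (mem_Ioi.2 hy)]
      exact le_self_add
    · exact le_add_left (not_lt.1 hy)

end Maximal

/-! ### The modular inequality under `∇₂`. -/

section Modular

variable {n : ℕ} {Φ : ℝ≥0 → ℝ≥0∞}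

/-- The terms vanish above `m` and at least halve at each step below it, so a geometric series
bounds the sum. -/
theorem ennreal_tsum_int_le {b : ℤ → ℝ≥0∞} {m : ℤ} (h0 : ∀ k, m < k → b k = 0)
    (h : ∀ k, b k ≤ b (k + 1) / 2 ∨ m ≤ k) : ∑' k, b k ≤ 2 * b m := by
  have hinj : Function.Injective fun j : ℕ => m - (j : ℤ) := fun i j hij => by simpa using hij
  rw [← hinj.tsum_eq]
  · have hb : ∀ j : ℕ, b (m - j) ≤ b m * 2⁻¹ ^ j := by
      intro j
      induction j with
      | zero => simp
      | succ j ih =>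
        rcases h (m - (j + 1 : ℕ)) with h | h
        · rw [show m - ((j + 1 : ℕ) : ℤ) + 1 = m - j by push_cast; ring] at h
          calc b (m - (j + 1 : ℕ)) ≤ b (m - j) / 2 := h
            _ ≤ b m * 2⁻¹ ^ j / 2 := by gcongr
            _ = b m * 2⁻¹ ^ (j + 1) := by rw [pow_succ, ← mul_assoc]; rfl
        · push_cast at h; omega
    refine (ENNReal.tsum_le_tsum hb).trans_eq ?_
    rw [ENNReal.tsum_mul_left, ENNReal.tsum_geometric, ENNReal.one_sub_inv_two, inv_inv, mul_comm]
  · intro k hk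
    rcases lt_or_ge m k with hmk | hmk
    · exact absurd (h0 k hmk) hk
    · exact ⟨(m - k).toNat, by simp only; omega⟩

/-- For finite `s > 0` the single term with `D^k < s ≤ D^(k+1)` suffices; for `s = ∞` the terms are
unbounded. -/
theorem youngExt_le_tsum (hΦ : IsYoung Φ) {D : ℝ≥0} (hD : 1 < D) (s : ℝ≥0∞) :
    youngExt Φ s ≤ ∑' k : ℤ, Φ (D ^ (k + 1)) *
      {k : ℤ | ((D ^ k : ℝ≥0) : ℝ≥0∞) < s}.indicator 1 k := by
  induction s using ENNReal.recTopCoe with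
  | top =>
    have hlim : Tendsto (fun k : ℕ => Φ (D ^ ((k : ℤ) + 1))) atTop (𝓝 ∞) := by
      refine hΦ.tendsto_top.comp ?_
      have := (tendsto_pow_atTop_atTop_of_one_lt hD).comp (tendsto_add_atTop_nat 1)
      exact this.congr fun k => by simp [← zpow_natCast]
    rw [youngExt_top]
    refine le_of_tendsto' hlim fun k => ?_
    refine le_trans (by simp) (ENNReal.le_tsum (k : ℤ))
  | coe s =>
    rcases eq_or_ne s 0 with rfl | hs
    · simp [hΦ.youngExt_zero]
    · obtain ⟨k, hk⟩ := exists_mem_Ioc_zpow (pos_iff_ne_zero.2 hs) hD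
      rw [youngExt_coe]
      refine le_trans ?_ (ENNReal.le_tsum k)
      rw [indicator_of_mem (by simpa using ENNReal.coe_lt_coe.2 hk.1), Pi.one_apply, mul_one]
      exact hΦ.monotone hk.2

/-- The `∇₂`-condition along a geometric sequence. -/
theorem tsum_dyadic_le (hΦ : IsYoung Φ) {D : ℝ≥0} (hD : 1 < D)
    (h2 : ∀ r : ℝ≥0, Φ r ≤ (2 * (D : ℝ≥0∞))⁻¹ * Φ (D * r)) {K : ℝ≥0} (hK : D ≤ K) (s : ℝ≥0∞) :
    ∑' k : ℤ, Φ (D ^ (k + 1)) * (((D ^ k : ℝ≥0) : ℝ≥0∞)⁻¹ *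
      (Ioi ((K * D ^ k : ℝ≥0) : ℝ≥0∞)).indicator id s) ≤ 2 * D * youngExt Φ s := by
  have hD0 : D ≠ 0 := (zero_lt_one.trans hD).ne'
  have hK0 : 0 < K := (zero_lt_one.trans hD).trans_le hK
  induction s using ENNReal.recTopCoe with
  | top => simp [hD0]
  | coe s =>
    rcases eq_or_ne s 0 with rfl | hs
    · simp
    -- `m` is the last index whose indicator is nonzero at `s`.
    obtain ⟨m, hm1, hm2⟩ := exists_mem_Ioc_zpow (x := s / K)
      (div_pos (pos_iff_ne_zero.2 hs) hK0) hD
    have hmem : ∀ k : ℤ, (s : ℝ≥0∞) ∈ Ioi ((K * D ^ k : ℝ≥0) : ℝ≥0∞) ↔ k ≤ m := by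
      intro k
      rw [mem_Ioi, ENNReal.coe_lt_coe, mul_comm, ← lt_div_iff₀ hK0]
      refine ⟨fun h => ?_, fun h => (zpow_le_zpow_right₀ hD.le h).trans_lt hm1⟩
      exact Int.lt_add_one_iff.1 ((zpow_lt_zpow_iff_right₀ hD).1 (h.trans_le hm2))
    refine (ennreal_tsum_int_le (m := m) (fun k hk => ?_) fun k => ?_).trans ?_
    · rw [indicator_of_notMem (by rw [hmem]; omega)]
      simp
    · rcases lt_or_ge k m with hkm | hkm
      · left
        rw [indicator_of_mem ((hmem _).2 hkm.le), indicator_of_mem ((hmem _).2 hkm)]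
        -- Of the gain `1/(2D)` from `∇₂`, the factor `1/D` pays for replacing `D^(-k)` by
        -- `D^(-(k+1))`, and the ratio `1/2` remains.
        have h := h2 (D ^ (k + 1))
        rw [← zpow_one_add₀ hD0, add_comm 1] at h
        calc Φ (D ^ (k + 1)) * (((D ^ k : ℝ≥0) : ℝ≥0∞)⁻¹ * s)
            ≤ (2 * D : ℝ≥0∞)⁻¹ * Φ (D ^ (k + 1 + 1)) * (((D ^ k : ℝ≥0) : ℝ≥0∞)⁻¹ * s) := by
              gcongr
          _ = Φ (D ^ (k + 1 + 1)) * (((D ^ (k + 1) : ℝ≥0) : ℝ≥0∞)⁻¹ * s) / 2 := by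
              rw [zpow_add_one₀ hD0 k, ENNReal.coe_mul, ENNReal.mul_inv (by simp) (by simp),
                ENNReal.mul_inv (by simp) (by simp), div_eq_mul_inv]
              ring
      · exact Or.inr hkm
    · rw [indicator_of_mem ((hmem m).2 le_rfl), mul_assoc]
      refine mul_le_mul' le_rfl ?_
      rw [id_eq, youngExt_coe]
      -- This is where `D ≤ K` enters; it allows convexity to compare `Φ(D^(m+1))` with `Φ(s)` in
      -- the top term.
      have hDm : D ^ (m + 1) ≤ s := by
        rw [zpow_add_one₀ hD0]
        calc D ^ m * D ≤ s / K * K := by gcongr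
          _ = s := div_mul_cancel₀ _ hK0.ne'
      have h := hΦ.map_mul_le (θ := D ^ (m + 1) / s) (div_le_one_of_le₀ hDm zero_le) s
      rw [div_mul_cancel₀ _ hs] at h
      calc Φ (D ^ (m + 1)) * (((D ^ m : ℝ≥0) : ℝ≥0∞)⁻¹ * s)
          ≤ (D ^ (m + 1) / s : ℝ≥0) * Φ s * (((D ^ m : ℝ≥0) : ℝ≥0∞)⁻¹ * s) := by gcongr
        _ = ((D ^ (m + 1) / s * ((D ^ m)⁻¹ * s) : ℝ≥0) : ℝ≥0∞) * Φ s := by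
          push_cast [ENNReal.coe_inv (zpow_ne_zero m hD0)]
          ring
        _ = D * Φ s := by
          congr 2
          rw [zpow_add_one₀ hD0]
          field_simp

/-- Under the `∇₂`-condition the maximal operator satisfies a modular inequality. -/
theorem exists_modular_hlMax_le (hn : n ≠ 0) (hΦ : IsYoung Φ) (h2 : Nabla2 Φ) :
    ∃ K : ℝ≥0, 0 < K ∧ ∀ u : Rn n → ℝ≥0∞, AEMeasurable u →
      ∫⁻ x, youngExt Φ (hlMax u x / K) ≤ ∫⁻ x, youngExt Φ (u x) := by
  obtain ⟨D, hD, h2⟩ := h2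
  have hD0 : 0 < D := zero_lt_one.trans hD
  -- Chosen so that `5^n / K = 1/(2D)`: the weak type constant then cancels the `2D` of
  -- `tsum_dyadic_le`, and the modular inequality has constant `1`.
  set K : ℝ≥0 := 2 * 5 ^ n * D with hKdef
  have hDK : D ≤ K := by
    refine le_mul_of_one_le_left' ?_
    exact one_le_mul (by norm_num) (one_le_pow₀ (by norm_num))
  have hK0 : 0 < K := hD0.trans_le hDK
  -- The extra `2` comes from the level `2a` in the truncated weak type bound.
  refine ⟨2 * K, by positivity, fun u hu => ?_⟩
  have hset : ∀ k : ℤ, MeasurableSet {x | (2 * (K * D ^ k : ℝ≥0) : ℝ≥0∞) < hlMax u x} := fun k =>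
    measurableSet_lt measurable_const (measurable_hlMax u)
  have hweak : ∀ k : ℤ, volume {x | (2 * (K * D ^ k : ℝ≥0) : ℝ≥0∞) < hlMax u x} ≤
      (2 * D : ℝ≥0∞)⁻¹ * (((D ^ k : ℝ≥0) : ℝ≥0∞)⁻¹ *
        ∫⁻ x, (Ioi ((K * D ^ k : ℝ≥0) : ℝ≥0∞)).indicator id (u x)) := by
    intro k
    have hDk : 0 < D ^ k := zpow_pos hD0 k
    have h := mul_volume_lt_hlMax_le_indicator hn u (mul_pos hK0 hDk)
    have hne : ((K * D ^ k : ℝ≥0) : ℝ≥0∞) ≠ 0 := by positivity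
    rw [mul_comm, ← ENNReal.le_div_iff_mul_le (Or.inl hne) (Or.inl ENNReal.coe_ne_top)] at h
    refine h.trans_eq ?_
    rw [ENNReal.div_eq_inv_mul, ← mul_assoc, ← mul_assoc]
    congr 1
    have hK : (K * D ^ k)⁻¹ * 5 ^ n = (2 * D)⁻¹ * (D ^ k)⁻¹ := by
      rw [hKdef]
      field_simp
    have h5 := congrArg (fun c : ℝ≥0 => (c : ℝ≥0∞)) hK
    simp only [ENNReal.coe_mul] at h5
    rw [ENNReal.coe_inv (by positivity), ENNReal.coe_inv (by positivity),
      ENNReal.coe_inv (by positivity)] at h5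
    push_cast at h5 ⊢
    exact h5
  calc ∫⁻ x, youngExt Φ (hlMax u x / (2 * K : ℝ≥0))
      ≤ ∫⁻ x, ∑' k : ℤ, Φ (D ^ (k + 1)) *
          {x | (2 * (K * D ^ k : ℝ≥0) : ℝ≥0∞) < hlMax u x}.indicator 1 x := by
        refine lintegral_mono fun x => (youngExt_le_tsum hΦ hD _).trans_eq ?_
        refine tsum_congr fun k => ?_
        congr 1
        simp only [indicator, mem_ofPred_eq]
        congr 1
        rw [ENNReal.lt_div_iff_mul_lt (Or.inl (ENNReal.coe_ne_zero.2 (by positivity)))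
          (Or.inl ENNReal.coe_ne_top)]
        simp only [ENNReal.coe_mul, ENNReal.coe_ofNat]
        rw [mul_left_comm, mul_comm ((D ^ k : ℝ≥0) : ℝ≥0∞)]
    _ = ∑' k : ℤ, Φ (D ^ (k + 1)) *
          volume {x | (2 * (K * D ^ k : ℝ≥0) : ℝ≥0∞) < hlMax u x} := by
        rw [lintegral_tsum fun k =>
          ((measurable_one.indicator (hset k)).const_mul _).aemeasurable]
        refine tsum_congr fun k => ?_
        rw [lintegral_const_mul _ (measurable_one.indicator (hset k)),
          lintegral_indicator_one (hset k)]
    _ ≤ ∑' k : ℤ, Φ (D ^ (k + 1)) * ((2 * D : ℝ≥0∞)⁻¹ * (((D ^ k : ℝ≥0) : ℝ≥0∞)⁻¹ *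
          ∫⁻ x, (Ioi ((K * D ^ k : ℝ≥0) : ℝ≥0∞)).indicator id (u x))) := by
        gcongr with k
        exact hweak k
    _ = (2 * D : ℝ≥0∞)⁻¹ * ∫⁻ x, ∑' k : ℤ, Φ (D ^ (k + 1)) * (((D ^ k : ℝ≥0) : ℝ≥0∞)⁻¹ *
          (Ioi ((K * D ^ k : ℝ≥0) : ℝ≥0∞)).indicator id (u x)) := by
        have hm : ∀ k : ℤ, AEMeasurable fun x =>
            (Ioi ((K * D ^ k : ℝ≥0) : ℝ≥0∞)).indicator id (u x) := fun k =>
          (measurable_id.indicator measurableSet_Ioi).comp_aemeasurable hu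
        rw [lintegral_tsum fun k => ((hm k).const_mul _).const_mul _, ← ENNReal.tsum_mul_left]
        refine tsum_congr fun k => ?_
        rw [lintegral_const_mul'' _ ((hm k).const_mul _), lintegral_const_mul'' _ (hm k),
          mul_left_comm]
    _ ≤ (2 * D : ℝ≥0∞)⁻¹ * ∫⁻ x, 2 * D * youngExt Φ (u x) := by
        gcongr with x
        exact tsum_dyadic_le hΦ hD h2 hDK (u x)
    _ = ∫⁻ x, youngExt Φ (u x) := by
        rw [lintegral_const_mul' _ _ (by finiteness), ← mul_assoc,
          ENNReal.inv_mul_cancel (by simp [hD0.ne']) (by finiteness), one_mul]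

end Modular

/-! ### Averages and constants on balls. -/

section Balls

variable {n : ℕ} {Φ : ℝ≥0 → ℝ≥0∞}

theorem inv_volume_ball_pos (x : Rn n) (r : ℝ) : 0 < (volume (Metric.ball x r))⁻¹ :=
  ENNReal.inv_pos.2 (volume_ball_ne_top x r)

theorem inv_volume_ball_lt_top (x : Rn n) {r : ℝ} (hr : 0 < r) :
    (volume (Metric.ball x r))⁻¹ < ∞ :=
  ENNReal.inv_lt_top.2 (volume_ball_pos x hr)

theorem IsYoung.youngInv_ball_ne_zero (hΦ : IsYoung Φ) (x : Rn n) (r : ℝ) :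
    youngInv Φ (volume (Metric.ball x r))⁻¹ ≠ 0 :=
  (hΦ.youngInv_pos (inv_volume_ball_pos x r)).ne'

theorem IsYoung.youngInv_ball_ne_top (hΦ : IsYoung Φ) (x : Rn n) {r : ℝ} (hr : 0 < r) :
    youngInv Φ (volume (Metric.ball x r))⁻¹ ≠ ∞ :=
  (hΦ.youngInv_lt_top (inv_volume_ball_lt_top x hr)).ne

theorem IsYoung.youngInv_ball_le_two_mul (hΦ : IsYoung Φ) (x : Rn n) (r : ℝ) :
    youngInv Φ (volume (Metric.ball x r))⁻¹ ≤
      (2 ^ n : ℝ≥0) * youngInv Φ (volume (Metric.ball x (2 * r)))⁻¹ := by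
  rw [inv_volume_ball_le x x r]
  exact hΦ.youngInv_mul_le (one_le_pow₀ one_le_two) _

/-- The average over a ball is controlled by the Luxemburg norm. -/
theorem IsYoung.average_ball_le (hΦ : IsYoung Φ) (u : Rn n → ℝ≥0∞) (x : Rn n) {t : ℝ}
    (ht : 0 < t) :
    (volume (Metric.ball x t))⁻¹ * ∫⁻ y in Metric.ball x t, u y ≤
      2 * (youngInv Φ (volume (Metric.ball x t))⁻¹ *
        orliczNorm Φ ((Metric.ball x t).indicator u)) := by
  set B := Metric.ball x t
  set s := (volume B)⁻¹ with hs
  set X := s * ∫⁻ y in B, u y with hX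
  have hB : MeasurableSet B := Metric.isOpen_ball.measurableSet
  have hsT : s ≠ ∞ := (inv_volume_ball_lt_top x ht).ne
  have hsB : s * volume B = 1 :=
    ENNReal.inv_mul_cancel (volume_ball_pos x ht).ne' (volume_ball_ne_top x t)
  have hY0 := hΦ.youngInv_ball_ne_zero x t
  have hYT := hΦ.youngInv_ball_ne_top x ht
  have key : ∀ c : ℝ≥0, 0 < c → ∫⁻ y, youngExt Φ (‖B.indicator u y‖ₑ / c) ≤ 1 →
      ∀ r : ℝ≥0, s < Φ r → X ≤ r * (2 * c) := by
    intro c hc h r hr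
    have hc' : (c : ℝ≥0∞) ≠ 0 := ENNReal.coe_ne_zero.2 hc.ne'
    have h1 : ∫⁻ y in B, youngExt Φ (u y / c) ≤ 1 := by
      refine le_trans (le_of_eq (setLIntegral_congr_fun hB fun y hy => ?_))
        ((setLIntegral_le_lintegral B _).trans h)
      simp [indicator_of_mem hy]
    -- `IsYoung.le_add_mul_youngExt` is integrated over the ball with `s = |B|⁻¹`: each of the two
    -- terms contributes at most `r`. The infimum over admissible `r` then produces `Φ⁻¹(s)`.
    have h2 : X / c ≤ r * 2 := by
      calc X / c = ∫⁻ y in B, u y / c * s := by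
            simp only [div_eq_mul_inv]
            rw [lintegral_mul_const' _ _ hsT, lintegral_mul_const' _ _ (by simpa using hc.ne'), hX]
            ring
        _ ≤ ∫⁻ y in B, (r * s + r * youngExt Φ (u y / c)) :=
            lintegral_mono fun y => hΦ.le_add_mul_youngExt hr _
        _ = r * (s * volume B) + r * ∫⁻ y in B, youngExt Φ (u y / c) := by
            rw [lintegral_add_left measurable_const, setLIntegral_const,
              lintegral_const_mul' _ _ ENNReal.coe_ne_top, mul_assoc]
        _ ≤ r * 1 + r * 1 := by rw [hsB]; gcongr
        _ = r * 2 := by ring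
    rw [ENNReal.div_le_iff hc' ENNReal.coe_ne_top] at h2
    rwa [mul_assoc] at h2
  have h2Y0 : 2 * youngInv Φ s ≠ 0 := mul_ne_zero two_ne_zero hY0
  have h2YT : 2 * youngInv Φ s ≠ ∞ := ENNReal.mul_ne_top (by simp) hYT
  rw [← mul_assoc, mul_comm, ← ENNReal.div_le_iff h2Y0 h2YT]
  refine le_orliczNorm fun c hc h => ?_
  have hc0 : 2 * (c : ℝ≥0∞) ≠ 0 := by simp [hc.ne']
  rw [ENNReal.div_le_iff h2Y0 h2YT, mul_left_comm, ← mul_assoc, mul_comm,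
    ← ENNReal.div_le_iff hc0 (by finiteness)]
  refine le_iInf₂ fun r hr => ?_
  rw [ENNReal.div_le_iff hc0 (by finiteness)]
  exact key c hc h r hr

/-- If `r < Φ⁻¹(|B|⁻¹)` then `Φ(r) |B| ≤ 1`, so `1/r` is admissible in the Luxemburg norm of the
indicator. -/
theorem IsYoung.youngInv_mul_orliczNorm_one_le (hΦ : IsYoung Φ) (x : Rn n) {t : ℝ}
    (ht : 0 < t) :
    youngInv Φ (volume (Metric.ball x t))⁻¹ *
      orliczNorm Φ ((Metric.ball x t).indicator (1 : Rn n → ℝ≥0∞)) ≤ 1 := by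
  set B := Metric.ball x t
  have hB : MeasurableSet B := Metric.isOpen_ball.measurableSet
  rw [← ENNReal.le_inv_iff_mul_le]
  refine ENNReal.le_of_forall_nnreal_lt fun r hr => ?_
  rcases eq_or_ne r 0 with rfl | hr0
  · simp
  rw [ENNReal.le_inv_iff_le_inv, ← ENNReal.coe_inv hr0]
  refine orliczNorm_le (by positivity) ?_
  have : ∀ y, youngExt Φ (‖B.indicator (1 : Rn n → ℝ≥0∞) y‖ₑ / (r⁻¹ : ℝ≥0)) =
      B.indicator (fun _ => Φ r) y := by
    intro y
    by_cases hy : y ∈ B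
    · simp [indicator_of_mem hy, ENNReal.coe_inv hr0]
    · simp [indicator_of_notMem hy, hΦ.youngExt_zero]
  rw [lintegral_congr this, lintegral_indicator_const hB]
  refine (mul_le_mul' (map_le_of_lt_youngInv hr) le_rfl).trans_eq ?_
  exact ENNReal.inv_mul_cancel (volume_ball_pos x ht).ne' (volume_ball_ne_top x t)

theorem IsYoung.youngInv_mul_orliczNorm_const_le (hΦ : IsYoung Φ) (x : Rn n) {t : ℝ}
    (ht : 0 < t) (a : ℝ≥0∞) :
    youngInv Φ (volume (Metric.ball x t))⁻¹ *
      orliczNorm Φ ((Metric.ball x t).indicator fun _ => a) ≤ a := by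
  induction a using ENNReal.recTopCoe with
  | top => exact le_top
  | coe a =>
    have h : ((Metric.ball x t).indicator fun _ => (a : ℝ≥0∞)) =
        fun y => a * (Metric.ball x t).indicator (1 : Rn n → ℝ≥0∞) y := by
      funext y
      simp [indicator]
    rw [h]
    calc _ ≤ youngInv Φ (volume (Metric.ball x t))⁻¹ *
          (a * orliczNorm Φ ((Metric.ball x t).indicator (1 : Rn n → ℝ≥0∞))) := by
          gcongr
          exact orliczNorm_const_mul_le hΦ.youngExt_zero _ a
      _ ≤ a * 1 := by
          rw [mul_left_comm]
          gcongr
          exact hΦ.youngInv_mul_orliczNorm_one_le x ht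
      _ = a := mul_one _

theorem le_youngInv_mul_orliczNorm_const (hΦ : Monotone Φ) (x : Rn n) {t : ℝ} (ht : 0 < t)
    (hY0 : youngInv Φ (volume (Metric.ball x t))⁻¹ ≠ 0)
    (hYT : youngInv Φ (volume (Metric.ball x t))⁻¹ ≠ ∞) (a : ℝ≥0) :
    a ≤ youngInv Φ (volume (Metric.ball x t))⁻¹ *
      orliczNorm Φ ((Metric.ball x t).indicator fun _ => (a : ℝ≥0∞)) := by
  set B := Metric.ball x t
  have hB : MeasurableSet B := Metric.isOpen_ball.measurableSet
  rw [mul_comm, ← ENNReal.div_le_iff hY0 hYT]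
  refine le_orliczNorm fun c hc h => ?_
  rw [ENNReal.div_le_iff hY0 hYT, mul_comm, ← ENNReal.div_le_iff (by simp [hc.ne']) (by simp),
    ← ENNReal.coe_div hc.ne']
  refine le_youngInv hΦ ?_
  rw [← one_div, ENNReal.le_div_iff_mul_le (Or.inl (volume_ball_pos x ht).ne')
    (Or.inl (volume_ball_ne_top x t)), ← setLIntegral_const]
  refine le_trans (le_of_eq (setLIntegral_congr_fun hB fun y hy => ?_))
    ((setLIntegral_le_lintegral B _).trans h)
  have hBy : B.indicator (fun _ => (a : ℝ≥0∞)) y = a := indicator_of_mem hy _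
  simp only [enorm_eq_self]
  rw [hBy, ← ENNReal.coe_div hc.ne', youngExt_coe]

end Balls

/-! ### Generalized Orlicz–Morrey norms and the maximal operator on them. -/

section Morrey

variable {n : ℕ} {Φ : ℝ≥0 → ℝ≥0∞} {φ : Rn n → ℝ → ℝ}

section General

variable {ε : Type*} [TopologicalSpace ε] [ENormedAddMonoid ε]

theorem orliczNorm_indicator_enorm (B : Set (Rn n)) (f : Rn n → ε) :
    orliczNorm Φ (B.indicator fun x => ‖f x‖ₑ) = orliczNorm Φ (B.indicator f) := by
  simp [orliczNorm, enorm_indicator_eq_indicator_enorm]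

theorem orliczMorreyNorm_enorm (f : Rn n → ε) :
    orliczMorreyNorm Φ φ (fun x => ‖f x‖ₑ) = orliczMorreyNorm Φ φ f := by
  simp only [orliczMorreyNorm, orliczNorm_indicator_enorm]

theorem le_orliczMorreyNorm (f : Rn n → ε) (x : Rn n) {r : ℝ} (hr : 0 < r) :
    (ENNReal.ofReal (φ x r))⁻¹ * youngInv Φ (volume (Metric.ball x r))⁻¹ *
      orliczNorm Φ ((Metric.ball x r).indicator f) ≤ orliczMorreyNorm Φ φ f :=
  le_iSup_of_le x (le_iSup_of_le r (le_iSup_of_le hr le_rfl))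

theorem youngInv_mul_orliczNorm_le (hφ : ∀ x r, 0 < r → 0 < φ x r) (f : Rn n → ε) (x : Rn n)
    {r : ℝ} (hr : 0 < r) :
    youngInv Φ (volume (Metric.ball x r))⁻¹ * orliczNorm Φ ((Metric.ball x r).indicator f) ≤
      ENNReal.ofReal (φ x r) * orliczMorreyNorm Φ φ f := by
  have h := le_orliczMorreyNorm (Φ := Φ) (φ := φ) f x hr
  have h0 : ENNReal.ofReal (φ x r) ≠ 0 := (ENNReal.ofReal_pos.2 (hφ x r hr)).ne'
  rw [mul_assoc, ← ENNReal.div_eq_inv_mul, ENNReal.div_le_iff h0 ENNReal.ofReal_ne_top] at h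
  rwa [mul_comm (ENNReal.ofReal _)]

theorem orliczNorm_ball_lt_top (hφ : ∀ x r, 0 < r → 0 < φ x r) {f : Rn n → ε}
    (hf : orliczMorreyNorm Φ φ f < ∞) (x : Rn n) {r : ℝ} (hr : 0 < r)
    (hY : youngInv Φ (volume (Metric.ball x r))⁻¹ ≠ 0) :
    orliczNorm Φ ((Metric.ball x r).indicator f) < ∞ := by
  by_contra! h
  have h1 := youngInv_mul_orliczNorm_le (Φ := Φ) hφ f x hr
  rw [top_le_iff.1 h, ENNReal.mul_top hY, top_le_iff] at h1
  exact ENNReal.mul_ne_top ENNReal.ofReal_ne_top hf.ne h1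

theorem memOrliczMorrey_of_lt_top (hφ : ∀ x r, 0 < r → 0 < φ x r)
    (hY : ∀ (x : Rn n) (r : ℝ), 0 < r → youngInv Φ (volume (Metric.ball x r))⁻¹ ≠ 0) {f : Rn n → ε}
    (hm : AEStronglyMeasurable f) (hf : orliczMorreyNorm Φ φ f < ∞)
    (hint : ∀ (x : Rn n) (r : ℝ), 0 < r → ∫⁻ y in Metric.ball x r, ‖f y‖ₑ < ∞) :
    MemOrliczMorrey Φ φ f := by
  refine ⟨fun x r hr => ⟨?_, ?_⟩, hf⟩
  · have hB : MeasurableSet (Metric.ball x r) := Metric.isOpen_ball.measurableSet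
    refine Integrable.locallyIntegrable ⟨hm.indicator hB, ?_⟩
    rw [hasFiniteIntegral_iff_enorm]
    simp only [enorm_indicator_eq_indicator_enorm]
    rw [lintegral_indicator hB]
    exact hint x r hr
  · obtain ⟨c, hc, h, -⟩ := exists_of_orliczNorm_lt (orliczNorm_ball_lt_top hφ hf x hr (hY x r hr))
    refine ⟨c⁻¹, by positivity, lt_of_le_of_lt ?_ ENNReal.one_lt_top⟩
    rw [ENNReal.coe_inv hc.ne']
    simpa only [ENNReal.div_eq_inv_mul] using h

end General

/-- The norm over `B(x,t)` is at most the norm over `B(x,s)` for every `s > t`, so the Morrey bound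
at `s` may be optimized over `s`. This produces the essential infimum of the maximal condition. -/
theorem IsYoung.youngInv_mul_orliczNorm_le_of_essInf (hΦ : IsYoung Φ)
    (hφ : ∀ x r, 0 < r → 0 < φ x r) {C : ℝ≥0}
    (hC : ∀ (x : Rn n) (r : ℝ), 0 < r →
      (⨆ (t : ℝ) (_ : r < t), youngInv Φ (volume (Metric.ball x t))⁻¹ *
        essInf (fun s : ℝ =>
          ENNReal.ofReal (φ x s) / youngInv Φ (volume (Metric.ball x s))⁻¹)
            (volume.restrict (Ioi t))) ≤ C * ENNReal.ofReal (φ x r))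
    {u : Rn n → ℝ≥0∞} (hu : orliczMorreyNorm Φ φ u < ∞) (x : Rn n) {r t : ℝ} (hr : 0 < r)
    (hrt : r < t) :
    youngInv Φ (volume (Metric.ball x t))⁻¹ * orliczNorm Φ ((Metric.ball x t).indicator u) ≤
      C * ENNReal.ofReal (φ x r) * orliczMorreyNorm Φ φ u := by
  set N := orliczMorreyNorm Φ φ u
  set g := fun s : ℝ => ENNReal.ofReal (φ x s) / youngInv Φ (volume (Metric.ball x s))⁻¹
  set X := orliczNorm Φ ((Metric.ball x t).indicator u)
  have hX : ∀ s, t < s → X ≤ g s * N := by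
    intro s hs
    have hs0 : 0 < s := hr.trans (hrt.trans hs)
    have h := youngInv_mul_orliczNorm_le (Φ := Φ) hφ u x hs0
    rw [mul_comm, ← ENNReal.le_div_iff_mul_le (Or.inl (hΦ.youngInv_ball_ne_zero x s))
      (Or.inl (hΦ.youngInv_ball_ne_top x hs0))] at h
    refine (orliczNorm_mono hΦ.monotone fun y => ?_).trans (h.trans_eq ?_)
    · simp only [enorm_eq_self]
      exact indicator_le_indicator_of_subset (Metric.ball_subset_ball hs.le)
        (fun _ => zero_le) y
    · simp only [g, div_eq_mul_inv]
      ring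
  have hX' : X ≤ essInf g (volume.restrict (Ioi t)) * N := by
    rcases eq_or_ne N 0 with hN | hN
    · simpa [hN] using hX (t + 1) (by linarith)
    · rw [← ENNReal.div_le_iff hN hu.ne]
      refine le_essInf_of_ae_le _ ?_
      filter_upwards [ae_restrict_mem measurableSet_Ioi] with s hs
      rw [ENNReal.div_le_iff hN hu.ne]
      exact hX s hs
  calc _ ≤ youngInv Φ (volume (Metric.ball x t))⁻¹ *
        (essInf g (volume.restrict (Ioi t)) * N) := by gcongr
    _ ≤ C * ENNReal.ofReal (φ x r) * N := by
      rw [← mul_assoc]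
      refine mul_le_mul' ?_ le_rfl
      exact le_trans (le_iSup₂ (f := fun t (_ : r < t) =>
        youngInv Φ (volume (Metric.ball x t))⁻¹ * essInf g (volume.restrict (Ioi t))) t hrt)
        (hC x r hr)

/-- The maximal operator is bounded on generalized Orlicz–Morrey spaces. -/
theorem exists_orliczMorreyNorm_hlMax_le (hn : n ≠ 0) (hΦ : IsYoung Φ) (h2 : Nabla2 Φ)
    (hφ : ∀ x r, 0 < r → 0 < φ x r) (hM : MaximalCondition Φ φ) :
    ∃ C : ℝ≥0, ∀ u : Rn n → ℝ≥0∞, AEMeasurable u → orliczMorreyNorm Φ φ u < ∞ →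
      orliczMorreyNorm Φ φ (hlMax u) ≤ C * orliczMorreyNorm Φ φ u := by
  obtain ⟨C, hC⟩ := hM
  obtain ⟨K, hK0, hK⟩ := exists_modular_hlMax_le hn hΦ h2
  refine ⟨2 * (K * 2 ^ n * C + 2 ^ n * (2 * C)), fun u hu hN => ?_⟩
  have hYX := fun x r t (hr : 0 < r) (hrt : r < t) =>
    hΦ.youngInv_mul_orliczNorm_le_of_essInf hφ hC hN x hr hrt
  set N := orliczMorreyNorm Φ φ u
  refine iSup_le fun x => iSup_le fun r => iSup_le fun hr => ?_
  set a := ENNReal.ofReal (φ x r)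
  have ha0 : a ≠ 0 := (ENNReal.ofReal_pos.2 (hφ x r hr)).ne'
  have haT : a ≠ ∞ := ENNReal.ofReal_ne_top
  set Y := youngInv Φ (volume (Metric.ball x r))⁻¹
  set A : ℝ≥0∞ := (2 ^ n : ℝ≥0) * (2 * (C * a * N))
  set B := Metric.ball x r
  set B₂ := Metric.ball x (2 * r)
  have hB : MeasurableSet B := Metric.isOpen_ball.measurableSet
  have hB₂ : MeasurableSet B₂ := Metric.isOpen_ball.measurableSet
  -- For `y` in `B(x,r)`, radii `t ≤ r` keep `B(y,t)` inside `B(x,2r)`, whereas for `t > r` it lies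
  -- in `B(x,2t)`, whose average is at most `2 C φ(r) N`; the factor `2^n` compares the two volumes.
  have hpt : ∀ y ∈ B, hlMax u y ≤ max (hlMax (B₂.indicator u) y) A := by
    intro y hy
    refine iSup₂_le fun t ht => ?_
    have hyx : dist y x < r := hy
    rcases le_or_gt t r with htr | hrt
    · refine le_max_of_le_left (le_trans (le_of_eq ?_) (le_hlMax _ y ht))
      congr 1
      refine setLIntegral_congr_fun Metric.isOpen_ball.measurableSet fun z hz => ?_
      exact (indicator_of_mem (Metric.ball_subset_ball' (by linarith) hz) u).symm
    · refine le_max_of_le_right ?_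
      rw [inv_volume_ball_le y x t, mul_assoc]
      refine mul_le_mul' le_rfl ?_
      calc _ ≤ (volume (Metric.ball x (2 * t)))⁻¹ * ∫⁻ z in Metric.ball x (2 * t), u z :=
            mul_le_mul' le_rfl (lintegral_mono_set (Metric.ball_subset_ball' (by linarith)))
        _ ≤ _ := hΦ.average_ball_le u x (by linarith)
        _ ≤ 2 * (C * a * N) := mul_le_mul' le_rfl (hYX x r (2 * t) hr (by linarith))
  have hnorm : orliczNorm Φ (B.indicator (hlMax u)) ≤
      2 * max (orliczNorm Φ (hlMax (B₂.indicator u))) (orliczNorm Φ (B.indicator fun _ => A)) := by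
    refine hΦ.orliczNorm_le_two_mul_max (measurable_const.indicator hB).aemeasurable fun y => ?_
    by_cases hy : y ∈ B
    · simpa [indicator_of_mem hy] using hpt y hy
    · simp [indicator_of_notMem hy]
  have hlux : orliczNorm Φ (hlMax (B₂.indicator u)) ≤ K * orliczNorm Φ (B₂.indicator u) := by
    refine orliczNorm_le_of_modular hK0 fun c hc => ?_
    have h := hK (fun y => B₂.indicator u y / c) ((hu.indicator hB₂).div_const _)
    simpa only [hlMax_div _ hc] using h
  have h1 : Y * orliczNorm Φ (hlMax (B₂.indicator u)) ≤ K * 2 ^ n * C * (a * N) := by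
    calc _ ≤ ((2 ^ n : ℝ≥0) * youngInv Φ (volume B₂)⁻¹) * (K * orliczNorm Φ (B₂.indicator u)) :=
          mul_le_mul' (hΦ.youngInv_ball_le_two_mul x r) hlux
      _ = K * 2 ^ n * (youngInv Φ (volume B₂)⁻¹ * orliczNorm Φ (B₂.indicator u)) := by
          push_cast; ring
      _ ≤ K * 2 ^ n * (C * a * N) :=
          mul_le_mul' le_rfl (hYX x r (2 * r) hr (by linarith))
      _ = _ := by ring
  have h2 : Y * orliczNorm Φ (B.indicator fun _ => A) ≤ 2 ^ n * (2 * C) * (a * N) := by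
    refine (hΦ.youngInv_mul_orliczNorm_const_le x hr A).trans_eq ?_
    simp only [A]
    push_cast
    ring
  rw [mul_assoc, ← ENNReal.div_eq_inv_mul, ENNReal.div_le_iff ha0 haT]
  calc Y * orliczNorm Φ (B.indicator (hlMax u))
      ≤ Y * (2 * (orliczNorm Φ (hlMax (B₂.indicator u)) +
          orliczNorm Φ (B.indicator fun _ => A))) := by
        refine mul_le_mul' le_rfl (hnorm.trans (mul_le_mul' le_rfl ?_))
        exact max_le_add_of_nonneg zero_le zero_le
    _ = 2 * (Y * orliczNorm Φ (hlMax (B₂.indicator u)) +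
          Y * orliczNorm Φ (B.indicator fun _ => A)) := by ring
    _ ≤ 2 * (K * 2 ^ n * C * (a * N) + 2 ^ n * (2 * C) * (a * N)) := by gcongr
    _ = _ := by push_cast; ring

end Morrey

/-! ### Hedberg's inequality and sufficiency. -/

section FractionalMaximal

variable {n : ℕ} {Φ Ψ : ℝ≥0 → ℝ≥0∞} {α β : ℝ}

theorem fracMax_enorm {ε : Type*} [TopologicalSpace ε] [ENormedAddMonoid ε] (α : ℝ)
    (f : Rn n → ε) : fracMax α (fun x => ‖f x‖ₑ) = fracMax α f := by
  funext x
  simp [fracMax]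

theorem measurable_fracMax (α : ℝ) (u : Rn n → ℝ≥0∞) : Measurable (fracMax α u) := by
  have h := lowerSemicontinuous_iSup_ball
    (fun t => (volume (Metric.ball (0 : Rn n) t)) ^ (-1 + α / (n : ℝ))) u
  have heq : fracMax α u = fun x => ⨆ (t : ℝ) (_ : 0 < t),
      (volume (Metric.ball (0 : Rn n) t)) ^ (-1 + α / (n : ℝ)) *
        ∫⁻ y in Metric.ball x t, u y := by
    funext x
    simp only [fracMax, volume_ball_eq x 0, enorm_eq_self]
  rw [heq]
  exact h.measurable

theorem volume_ball_rpow (hn : n ≠ 0) (hα : 0 ≤ α) (x : Rn n) {t : ℝ} (ht : 0 < t) (c : ℝ) :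
    volume (Metric.ball x (t * c)) ^ (α / n) =
      ENNReal.ofReal (t ^ α) * volume (Metric.ball (0 : Rn n) c) ^ (α / n) := by
  have hn' : (n : ℝ) ≠ 0 := Nat.cast_ne_zero.2 hn
  rw [volume_ball_mul x 0 c ht, ENNReal.mul_rpow_of_nonneg _ _ (by positivity),
    ← ENNReal.rpow_natCast, ← ENNReal.rpow_mul, mul_div_cancel₀ _ hn',
    ENNReal.ofReal_rpow_of_pos ht]

theorem volume_ball_rpow_neg_one_add (x : Rn n) {t : ℝ} (ht : 0 < t) (p : ℝ) :
    volume (Metric.ball x t) ^ (-1 + p) =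
      volume (Metric.ball x t) ^ p * (volume (Metric.ball x t))⁻¹ := by
  rw [ENNReal.rpow_add _ _ (volume_ball_pos x ht).ne' (volume_ball_ne_top x t),
    ENNReal.rpow_neg_one, mul_comm]

/-- Hedberg type pointwise estimate for the fractional maximal function. -/
theorem exists_fracMax_le (hn : n ≠ 0) (hα : 0 < α) (hβ : 0 < β) (hβ1 : β < 1)
    (hΦ : IsYoung Φ) {φ : ℝ → ℝ} (hφ : ∀ t, 0 < t → 0 < φ t)
    {C : ℝ} (hC : ∀ t, 0 < t → t ^ α * φ t ≤ C * φ t ^ β) :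
    ∃ K : ℝ≥0, ∀ (u : Rn n → ℝ≥0∞) (x : Rn n), fracMax α u x ≤
      K * orliczMorreyNorm Φ (fun _ : Rn n => φ) u ^ (1 - β) * hlMax u x ^ β := by
  have hβ' : 0 < 1 - β := sub_pos.2 hβ1
  set V := volume (Metric.ball (0 : Rn n) 1) ^ (α / n) with hV
  have hVT : V ≠ ∞ := ENNReal.rpow_ne_top_of_nonneg (by positivity) (volume_ball_ne_top _ _)
  have hKT : V * ENNReal.ofReal C * 2 ^ (1 - β) ≠ ∞ := by
    refine ENNReal.mul_ne_top (ENNReal.mul_ne_top hVT ENNReal.ofReal_ne_top) ?_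
    exact ENNReal.rpow_ne_top_of_nonneg hβ'.le (by simp)
  refine ⟨(V * ENNReal.ofReal C * 2 ^ (1 - β)).toNNReal, fun u x => ?_⟩
  rw [ENNReal.coe_toNNReal hKT]
  set N := orliczMorreyNorm Φ (fun _ : Rn n => φ) u
  refine iSup₂_le fun t ht => ?_
  simp only [enorm_eq_self]
  have hφt := hφ t ht
  have htφ : t ^ α * φ t ^ (1 - β) ≤ C := by
    rw [Real.rpow_sub hφt, Real.rpow_one, ← mul_div_assoc]
    exact div_le_of_le_mul₀ (by positivity)
      (nonneg_of_mul_nonneg_left ((by positivity : 0 ≤ t ^ α * φ t).trans (hC t ht)) (by positivity))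
      (hC t ht)
  set w := (volume (Metric.ball x t))⁻¹ * ∫⁻ y in Metric.ball x t, u y with hw
  have hw1 : w ≤ hlMax u x := le_hlMax u x ht
  have hw2 : w ≤ 2 * (ENNReal.ofReal (φ t) * N) := (hΦ.average_ball_le u x ht).trans
    (mul_le_mul' le_rfl
      (youngInv_mul_orliczNorm_le (φ := fun _ : Rn n => φ) (fun _ => hφ) u x ht))
  have hvol := volume_ball_rpow hn hα.le x ht 1
  rw [mul_one] at hvol
  rw [volume_ball_rpow_neg_one_add x ht, mul_assoc, ← hw, hvol]
  -- The average is interpolated: `Mu(x)` bounds the factor `w^β`, the Morrey norm bounds `w^(1-β)`.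
  calc ENNReal.ofReal (t ^ α) * V * w
      = ENNReal.ofReal (t ^ α) * V * (w ^ β * w ^ (1 - β)) := by
        rw [← ENNReal.rpow_add_of_nonneg _ _ hβ.le hβ'.le, add_sub_cancel, ENNReal.rpow_one]
    _ ≤ ENNReal.ofReal (t ^ α) * V *
          (hlMax u x ^ β * (2 * (ENNReal.ofReal (φ t) * N)) ^ (1 - β)) := by gcongr
    _ = ENNReal.ofReal (t ^ α * φ t ^ (1 - β)) *
          (V * 2 ^ (1 - β) * N ^ (1 - β) * hlMax u x ^ β) := by
        rw [ENNReal.mul_rpow_of_nonneg _ _ hβ'.le, ENNReal.mul_rpow_of_nonneg _ _ hβ'.le,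
          ENNReal.ofReal_rpow_of_pos hφt, ENNReal.ofReal_mul (by positivity)]
        ring
    _ ≤ ENNReal.ofReal C * (V * 2 ^ (1 - β) * N ^ (1 - β) * hlMax u x ^ β) := by gcongr
    _ = V * ENNReal.ofReal C * 2 ^ (1 - β) * N ^ (1 - β) * hlMax u x ^ β := by ring

theorem orliczMorreyNorm_rpow_le (hβ : 0 < β) (hΦ : IsYoung Φ)
    (hΨ : ∀ t : ℝ≥0, Ψ t = Φ (t ^ (1 / β))) {φ η : ℝ → ℝ} (hφ : ∀ t, 0 < t → 0 < φ t)
    (hη : ∀ t : ℝ, 0 < t → η t = φ t ^ β) {u v : Rn n → ℝ≥0∞} (a : ℝ≥0)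
    (h : ∀ x, v x ≤ a * u x ^ β) :
    orliczMorreyNorm Ψ (fun _ : Rn n => η) v ≤
      a * orliczMorreyNorm Φ (fun _ : Rn n => φ) u ^ β := by
  have hΨm := monotone_of_rpow hβ hΨ hΦ.monotone
  have hΨ0 : youngExt Ψ 0 = 0 := by
    have h0 := youngExt_rpow hβ hΨ 0
    rwa [ENNReal.zero_rpow_of_pos hβ, hΦ.youngExt_zero] at h0
  refine iSup_le fun x => iSup_le fun r => iSup_le fun hr => ?_
  set B := Metric.ball x r
  have hnorm : orliczNorm Ψ (B.indicator v) ≤ a * orliczNorm Φ (B.indicator u) ^ β := by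
    calc orliczNorm Ψ (B.indicator v)
        ≤ orliczNorm Ψ (fun y => a * B.indicator u y ^ β) := by
          refine orliczNorm_mono hΨm fun y => ?_
          by_cases hy : y ∈ B
          · simpa [indicator_of_mem hy] using h y
          · simp [indicator_of_notMem hy]
      _ ≤ a * orliczNorm Ψ (fun y => B.indicator u y ^ β) := orliczNorm_const_mul_le hΨ0 _ a
      _ ≤ a * orliczNorm Φ (B.indicator u) ^ β := by
          gcongr
          exact orliczNorm_rpow_le hβ hΨ _
  calc _ ≤ (ENNReal.ofReal (φ r) ^ β)⁻¹ * youngInv Φ (volume B)⁻¹ ^ β *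
        (a * orliczNorm Φ (B.indicator u) ^ β) := by
        refine mul_le_mul' (le_of_eq ?_) hnorm
        simp only [hη r hr, ← ENNReal.ofReal_rpow_of_pos (hφ r hr), youngInv_of_rpow hβ hΨ]
    _ = a * ((ENNReal.ofReal (φ r))⁻¹ * youngInv Φ (volume B)⁻¹ *
          orliczNorm Φ (B.indicator u)) ^ β := by
        rw [ENNReal.mul_rpow_of_nonneg _ _ hβ.le, ENNReal.mul_rpow_of_nonneg _ _ hβ.le,
          ENNReal.inv_rpow]
        ring
    _ ≤ _ := by
        gcongr
        exact le_orliczMorreyNorm (φ := fun _ : Rn n => φ) u x hr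

theorem aestronglyMeasurable_of_memOrliczLoc {𝕜 : Type*} [RCLike 𝕜] {f : Rn n → 𝕜}
    (hf : MemOrliczLoc Φ f) : AEStronglyMeasurable f := by
  have h : ∀ k : ℕ, AEStronglyMeasurable f (volume.restrict (Metric.ball 0 (k + 1))) := fun k =>
    (aestronglyMeasurable_indicator_iff Metric.isOpen_ball.measurableSet).1
      (hf 0 (k + 1) (by positivity)).1.aestronglyMeasurable
  have hU : ⋃ k : ℕ, Metric.ball (0 : Rn n) ((k : ℝ) + 1) = univ :=
    eq_univ_of_forall fun x => by
      obtain ⟨k, hk⟩ := exists_nat_gt (dist x 0)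
      exact mem_iUnion.2 ⟨k, by rw [Metric.mem_ball]; linarith⟩
  have h' := aestronglyMeasurable_iUnion_iff.2 h
  rwa [hU, Measure.restrict_univ] at h'

/-- The Hedberg factor `N^(1-β)` and the factor `N^β` from the maximal theorem recombine to `N`,
which makes the bound linear. -/
theorem fracMaxBounded_of_le (𝕜 : Type*) [RCLike 𝕜] (hn : n ≠ 0) (hα : 0 < α) (hβ : 0 < β)
    (hβ1 : β < 1) (hΦ : IsYoung Φ) (h2 : Nabla2 Φ) {φ η : ℝ → ℝ} (hφ : ∀ t, 0 < t → 0 < φ t)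
    (hΨ : ∀ t : ℝ≥0, Ψ t = Φ (t ^ (1 / β))) (hη : ∀ t : ℝ, 0 < t → η t = φ t ^ β)
    (hM : MaximalCondition Φ (fun _ : Rn n => φ))
    {C : ℝ} (hC : ∀ t, 0 < t → t ^ α * φ t ≤ C * φ t ^ β) :
    FracMaxBounded 𝕜 α Φ (fun _ : Rn n => φ) Ψ (fun _ => η) := by
  have hβ' : 0 < 1 - β := sub_pos.2 hβ1
  obtain ⟨A, hA⟩ := exists_orliczMorreyNorm_hlMax_le (φ := fun _ : Rn n => φ) hn hΦ h2
    (fun _ => hφ) hM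
  obtain ⟨K, hK⟩ := exists_fracMax_le (n := n) hn hα hβ hβ1 hΦ hφ hC
  refine ⟨K * A ^ β, fun f hf => ?_⟩
  set u : Rn n → ℝ≥0∞ := fun x => ‖f x‖ₑ with hu
  have hum : AEMeasurable u := (aestronglyMeasurable_of_memOrliczLoc hf.1).enorm
  rw [← fracMax_enorm, ← orliczMorreyNorm_enorm f]
  have hN : orliczMorreyNorm Φ (fun _ : Rn n => φ) u < ∞ := by
    rw [hu, orliczMorreyNorm_enorm]
    exact hf.2
  have hAu := hA u hum hN
  have hKu := hK u
  change MemOrliczMorrey Ψ _ (fracMax α u) ∧ orliczMorreyNorm Ψ _ (fracMax α u) ≤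
    _ * orliczMorreyNorm Φ _ u
  set N := orliczMorreyNorm Φ (fun _ : Rn n => φ) u
  have hcT : K * N ^ (1 - β) ≠ ∞ :=
    ENNReal.mul_ne_top ENNReal.coe_ne_top (ENNReal.rpow_ne_top_of_nonneg hβ'.le hN.ne)
  have hle : orliczMorreyNorm Ψ (fun _ : Rn n => η) (fracMax α u) ≤ (K * A ^ β : ℝ≥0) * N := by
    calc _ ≤ (K * N ^ (1 - β)).toNNReal *
          orliczMorreyNorm Φ (fun _ : Rn n => φ) (hlMax u) ^ β := by
          refine orliczMorreyNorm_rpow_le hβ hΦ hΨ hφ hη _ fun x => ?_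
          rw [ENNReal.coe_toNNReal hcT]
          exact hKu x
      _ ≤ K * N ^ (1 - β) * (A * N) ^ β := by
          rw [ENNReal.coe_toNNReal hcT]
          gcongr
      _ = (K * A ^ β : ℝ≥0) * (N ^ (1 - β) * N ^ β) := by
          rw [ENNReal.mul_rpow_of_nonneg _ _ hβ.le, ENNReal.coe_mul,
            ENNReal.coe_rpow_of_nonneg _ hβ.le]
          ring
      _ = (K * A ^ β : ℝ≥0) * N := by
          rw [← ENNReal.rpow_add_of_nonneg _ _ hβ'.le hβ.le, sub_add_cancel, ENNReal.rpow_one]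
  refine ⟨memOrliczMorrey_of_lt_top (fun _ t ht => ?_) (fun x r hr => ?_)
    (measurable_fracMax α u).aestronglyMeasurable
    (hle.trans_lt (ENNReal.mul_lt_top ENNReal.coe_lt_top hN)) (fun x r hr => ?_), hle⟩
  · rw [hη t ht]
    exact Real.rpow_pos_of_pos (hφ t ht) β
  · rw [youngInv_of_rpow hβ hΨ]
    exact (ENNReal.rpow_pos (pos_iff_ne_zero.2 (hΦ.youngInv_ball_ne_zero x r))
      (hΦ.youngInv_ball_ne_top x hr)).ne'
  -- Membership in the target also asks for local integrability. It follows from `(Mu)^β ≤ 1 + Mu`,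
  -- as `Mu` has finite Luxemburg norm on balls and hence finite averages.
  · have hmax : ∫⁻ y in Metric.ball x r, hlMax u y < ∞ := by
      have hX := orliczNorm_ball_lt_top (φ := fun _ : Rn n => φ) (fun _ => hφ)
        (hAu.trans_lt (ENNReal.mul_lt_top ENNReal.coe_lt_top hN)) x hr
        (hΦ.youngInv_ball_ne_zero x r)
      have h := hΦ.average_ball_le (hlMax u) x hr
      have hlt := h.trans_lt (ENNReal.mul_lt_top (by simp)
        (ENNReal.mul_lt_top (hΦ.youngInv_ball_ne_top x hr).lt_top hX))
      exact ENNReal.lt_top_of_mul_ne_top_right hlt.ne (inv_volume_ball_pos x r).ne'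
    simp only [enorm_eq_self]
    calc ∫⁻ y in Metric.ball x r, fracMax α u y
        ≤ ∫⁻ y in Metric.ball x r, K * N ^ (1 - β) * (1 + hlMax u y) := by
          refine lintegral_mono fun y => (hKu y).trans ?_
          gcongr
          rcases le_total (hlMax u y) 1 with h | h
          · exact (ENNReal.rpow_le_one h hβ.le).trans le_self_add
          · exact ((ENNReal.rpow_le_rpow_of_exponent_le h hβ1.le).trans_eq
              (ENNReal.rpow_one _)).trans le_add_self
      _ = K * N ^ (1 - β) * (volume (Metric.ball x r) + ∫⁻ y in Metric.ball x r, hlMax u y) := by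
          rw [lintegral_const_mul' _ _ hcT, lintegral_add_left measurable_const,
            setLIntegral_const, one_mul]
      _ < ∞ := ENNReal.mul_lt_top hcT.lt_top
          (ENNReal.add_lt_top.2 ⟨(volume_ball_ne_top x r).lt_top, hmax⟩)

end FractionalMaximal

/-! ### The class `G_Φ` and necessity by testing on balls. -/

section Necessity

variable {n : ℕ} {Φ Ψ : ℝ≥0 → ℝ≥0∞} {α β : ℝ} {φ η : ℝ → ℝ}

/-- The essential infimum over `s > t` is tested on `(t, 2t)`, where `Φ⁻¹(|B(x,t)|⁻¹)` and
`Φ⁻¹(|B(x,s)|⁻¹)` are comparable and `φ(s) ≤ C φ(r)`. -/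
theorem GClass.maximalCondition (hΦ : IsYoung Φ) (hG : GClass n Φ φ) :
    MaximalCondition Φ (fun _ : Rn n => φ) := by
  obtain ⟨C, hC0, hC⟩ := hG.almostDecreasing
  refine ⟨2 ^ n * C.toNNReal, fun x r hr => iSup₂_le fun t hrt => ?_⟩
  have ht : 0 < t := hr.trans hrt
  set Y := youngInv Φ (volume (Metric.ball x t))⁻¹
  have hY0 : Y ≠ 0 := hΦ.youngInv_ball_ne_zero x t
  have hYT : Y ≠ ∞ := hΦ.youngInv_ball_ne_top x ht
  rw [mul_comm, ← ENNReal.le_div_iff_mul_le (Or.inl hY0) (Or.inl hYT)]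
  by_contra! hlt
  have hae := ae_lt_of_lt_essInf hlt
  rw [ae_restrict_iff' measurableSet_Ioi] at hae
  have hpos : ∃ᵐ s : ℝ, s ∈ Ioo t (2 * t) := by
    rw [frequently_ae_mem_iff]
    simp [ht]
  obtain ⟨s, hs, hs'⟩ := (hpos.and_eventually hae).exists
  have h := hs' hs.1
  have hs0 : 0 < s := ht.trans hs.1
  rw [ENNReal.div_lt_iff (Or.inl hY0) (Or.inl hYT)] at h
  refine h.not_ge ?_
  have hYs : Y ≤ (2 ^ n : ℝ≥0) * youngInv Φ (volume (Metric.ball x s))⁻¹ := by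
    refine (hΦ.youngInv_ball_le_two_mul x t).trans (mul_le_mul' le_rfl ?_)
    exact youngInv_mono (ENNReal.inv_le_inv.2 (measure_mono (Metric.ball_subset_ball hs.2.le)))
  have hφs : ENNReal.ofReal (φ s) ≤ C.toNNReal * ENNReal.ofReal (φ r) := by
    refine (ENNReal.ofReal_le_ofReal (hC r s hr (hrt.trans hs.1).le)).trans_eq ?_
    rw [ENNReal.ofReal_mul hC0.le]
    rfl
  calc ENNReal.ofReal (φ s) / youngInv Φ (volume (Metric.ball x s))⁻¹ * Y
      ≤ ENNReal.ofReal (φ s) / youngInv Φ (volume (Metric.ball x s))⁻¹ *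
          ((2 ^ n : ℝ≥0) * youngInv Φ (volume (Metric.ball x s))⁻¹) := by gcongr
    _ = (2 ^ n : ℝ≥0) * ENNReal.ofReal (φ s) := by
        rw [mul_left_comm, ENNReal.div_mul_cancel (hΦ.youngInv_ball_ne_zero x s)
          (hΦ.youngInv_ball_ne_top x hs0)]
    _ ≤ (2 ^ n : ℝ≥0) * (C.toNNReal * ENNReal.ofReal (φ r)) := by gcongr
    _ = _ := by rw [ENNReal.coe_mul, mul_assoc]

/-- Reconciles the `t⁻ⁿ` in `G_Φ` with the `|B|⁻¹` in the Morrey norm: the two differ by the volume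
of the unit ball. -/
theorem exists_youngInv_ball_le (hΦ : IsYoung Φ) : ∃ K : ℝ≥0, ∀ (x : Rn n) (r : ℝ), 0 < r →
    youngInv Φ (volume (Metric.ball x r))⁻¹ ≤ K * youngInv Φ (ENNReal.ofReal r ^ n)⁻¹ ∧
    youngInv Φ (ENNReal.ofReal r ^ n)⁻¹ ≤ K * youngInv Φ (volume (Metric.ball x r))⁻¹ := by
  set V := volume (Metric.ball (0 : Rn n) 1)
  have hV0 : V ≠ 0 := (volume_ball_pos _ one_pos).ne'
  have hVT : V ≠ ∞ := volume_ball_ne_top _ _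
  set K : ℝ≥0 := max 1 (max V.toNNReal V⁻¹.toNNReal)
  have hK1 : 1 ≤ K := le_max_left _ _
  have hKV : V ≤ K := by
    rw [← ENNReal.coe_toNNReal hVT]
    exact_mod_cast (le_max_left _ _).trans (le_max_right _ _)
  have hKV' : V⁻¹ ≤ K := by
    rw [← ENNReal.coe_toNNReal (ENNReal.inv_ne_top.2 hV0)]
    exact_mod_cast (le_max_right _ _).trans (le_max_right _ _)
  refine ⟨K, fun x r hr => ?_⟩
  have hvol : (volume (Metric.ball x r))⁻¹ = V⁻¹ * (ENNReal.ofReal r ^ n)⁻¹ := by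
    have h := volume_ball_mul x 0 1 hr
    rw [mul_one] at h
    rw [h, ENNReal.mul_inv (Or.inr hVT) (Or.inr hV0), mul_comm]
  constructor
  · refine le_trans (youngInv_mono ?_) (hΦ.youngInv_mul_le hK1 _)
    rw [hvol]
    gcongr
  · refine le_trans (youngInv_mono ?_) (hΦ.youngInv_mul_le hK1 _)
    rw [hvol, ← mul_assoc]
    refine le_mul_of_one_le_left' ?_
    rw [← ENNReal.mul_inv_cancel hV0 hVT]
    gcongr

/-- On balls of radius `r ≤ t` the indicator is at most `1` and `φ(t) ≤ C φ(r)`. For `r ≥ t` the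
Luxemburg norm is at most that of the whole indicator, and the almost increasing quotient moves the
weight from `r` to `t`. -/
theorem GClass.exists_orliczMorreyNorm_indicator_le (hΦ : IsYoung Φ)
    (hG : GClass n Φ φ) : ∃ C : ℝ≥0, ∀ t : ℝ, 0 < t →
      orliczMorreyNorm Φ (fun _ : Rn n => φ)
        ((Metric.ball (0 : Rn n) t).indicator (1 : Rn n → ℝ≥0∞)) ≤
          C * (ENNReal.ofReal (φ t))⁻¹ := by
  obtain ⟨C, hC0, hC⟩ := hG.almostDecreasing
  obtain ⟨D, hD0, hD⟩ := hG.almostIncreasing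
  obtain ⟨K, hK⟩ := exists_youngInv_ball_le (n := n) hΦ
  refine ⟨C.toNNReal + K * D * K, fun t ht => ?_⟩
  have hpos := fun r hr => (ENNReal.ofReal_pos.2 (hG.pos r hr)).ne'
  refine iSup_le fun x => iSup_le fun r => iSup_le fun hr => ?_
  set χ := (Metric.ball (0 : Rn n) t).indicator (1 : Rn n → ℝ≥0∞)
  rcases le_total r t with hrt | htr
  · have h1 : youngInv Φ (volume (Metric.ball x r))⁻¹ *
        orliczNorm Φ ((Metric.ball x r).indicator χ) ≤ 1 := by
      refine le_trans (mul_le_mul' le_rfl (orliczNorm_mono hΦ.monotone fun y => ?_))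
        (hΦ.youngInv_mul_orliczNorm_one_le x hr)
      simp only [enorm_eq_self]
      refine indicator_le_indicator ?_
      exact indicator_le_self' (fun _ _ => zero_le) y
    have h2 : (ENNReal.ofReal (φ r))⁻¹ ≤ C.toNNReal * (ENNReal.ofReal (φ t))⁻¹ := by
      have hle : ENNReal.ofReal (φ t) ≤ C.toNNReal * ENNReal.ofReal (φ r) := by
        refine (ENNReal.ofReal_le_ofReal (hC r t hr hrt)).trans_eq ?_
        rw [ENNReal.ofReal_mul hC0.le]
        rfl
      rw [← div_eq_mul_inv, ENNReal.le_div_iff_mul_le (Or.inl (hpos t ht))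
        (Or.inl ENNReal.ofReal_ne_top), ← ENNReal.div_eq_inv_mul,
        ENNReal.div_le_iff (hpos r hr) ENNReal.ofReal_ne_top]
      exact hle
    calc _ ≤ C.toNNReal * (ENNReal.ofReal (φ t))⁻¹ * 1 := by
          rw [mul_assoc]
          exact mul_le_mul' h2 h1
      _ ≤ _ := by
          rw [mul_one]
          gcongr
          exact le_self_add
  · have hs : ∀ s : ℝ, 0 < s → youngInv Φ (ENNReal.ofReal s ^ n)⁻¹ ≠ 0 ∧
        youngInv Φ (ENNReal.ofReal s ^ n)⁻¹ ≠ ∞ := fun s hs =>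
      ⟨(hΦ.youngInv_pos (ENNReal.inv_pos.2 (by finiteness))).ne',
        (hΦ.youngInv_lt_top (ENNReal.inv_lt_top.2
          (ENNReal.pow_pos (ENNReal.ofReal_pos.2 hs) n))).ne⟩
    have hinc : (ENNReal.ofReal (φ r))⁻¹ * youngInv Φ (ENNReal.ofReal r ^ n)⁻¹ ≤
        D * ((ENNReal.ofReal (φ t))⁻¹ * youngInv Φ (ENNReal.ofReal t ^ n)⁻¹) := by
      have hone : ∀ s : ℝ, 0 < s →
          (ENNReal.ofReal (φ s))⁻¹ * youngInv Φ (ENNReal.ofReal s ^ n)⁻¹ *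
            (ENNReal.ofReal (φ s) / youngInv Φ (ENNReal.ofReal s ^ n)⁻¹) = 1 := fun s hs0 => by
        rw [div_eq_mul_inv, mul_mul_mul_comm,
          ENNReal.inv_mul_cancel (hpos s hs0) ENNReal.ofReal_ne_top,
          ENNReal.mul_inv_cancel (hs s hs0).1 (hs s hs0).2, one_mul]
      set G := fun s : ℝ => (ENNReal.ofReal (φ s))⁻¹ * youngInv Φ (ENNReal.ofReal s ^ n)⁻¹
      calc G r = G r * (G t * (ENNReal.ofReal (φ t) / youngInv Φ (ENNReal.ofReal t ^ n)⁻¹)) := by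
            rw [hone t ht, mul_one]
        _ ≤ G r * (G t *
            (D * (ENNReal.ofReal (φ r) / youngInv Φ (ENNReal.ofReal r ^ n)⁻¹))) := by
            gcongr
            exact hD t r ht htr
        _ = D * G t *
            (G r * (ENNReal.ofReal (φ r) / youngInv Φ (ENNReal.ofReal r ^ n)⁻¹)) := by ring
        _ = D * G t := by rw [hone r hr, mul_one]
    have h1 : orliczNorm Φ ((Metric.ball x r).indicator χ) ≤ orliczNorm Φ χ := by
      refine orliczNorm_mono hΦ.monotone fun y => ?_
      simp only [enorm_eq_self]
      exact indicator_le_self' (fun _ _ => zero_le) y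
    calc _ ≤ (ENNReal.ofReal (φ r))⁻¹ * (K * youngInv Φ (ENNReal.ofReal r ^ n)⁻¹) *
          orliczNorm Φ χ := by
          gcongr
          exact (hK x r hr).1
      _ = K * ((ENNReal.ofReal (φ r))⁻¹ * youngInv Φ (ENNReal.ofReal r ^ n)⁻¹) *
          orliczNorm Φ χ := by ring
      _ ≤ K * (D * ((ENNReal.ofReal (φ t))⁻¹ *
          (K * youngInv Φ (volume (Metric.ball (0 : Rn n) t))⁻¹))) * orliczNorm Φ χ := by
          refine mul_le_mul' (mul_le_mul' le_rfl (hinc.trans ?_)) le_rfl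
          gcongr
          exact (hK 0 t ht).2
      _ = K * D * K * (ENNReal.ofReal (φ t))⁻¹ *
          (youngInv Φ (volume (Metric.ball (0 : Rn n) t))⁻¹ * orliczNorm Φ χ) := by ring
      _ ≤ K * D * K * (ENNReal.ofReal (φ t))⁻¹ * 1 := by
          gcongr
          exact hΦ.youngInv_mul_orliczNorm_one_le 0 ht
      _ ≤ _ := by
          rw [mul_one]
          push_cast
          gcongr
          exact le_add_self

/-- For `x` in `B(0,t)` the ball `B(x,2t)` contains `B(0,t)`, so the single radius `2t` gives the
lower bound. -/
theorem exists_le_fracMax_indicator (hn : n ≠ 0) (hα : 0 < α) :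
    ∃ c : ℝ, 0 < c ∧ ∀ t : ℝ, 0 < t → ∀ x ∈ Metric.ball (0 : Rn n) t,
      ENNReal.ofReal (c * t ^ α) ≤
        fracMax α ((Metric.ball (0 : Rn n) t).indicator (1 : Rn n → ℝ≥0∞)) x := by
  set W := volume (Metric.ball (0 : Rn n) 2) ^ (α / n)
  have hW0 : W ≠ 0 :=
    (ENNReal.rpow_pos (volume_ball_pos _ two_pos) (volume_ball_ne_top _ _)).ne'
  have hWT : W ≠ ∞ := ENNReal.rpow_ne_top_of_nonneg (by positivity) (volume_ball_ne_top _ _)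
  have hc : 0 < (W * ((2 ^ n : ℝ≥0) : ℝ≥0∞)⁻¹).toReal :=
    ENNReal.toReal_pos (mul_ne_zero hW0 (by simp))
      (ENNReal.mul_ne_top hWT (by simp))
  refine ⟨_, hc, fun t ht x hx => ?_⟩
  have ht2 : 0 < t * 2 := by positivity
  refine le_trans ?_ (le_iSup₂ (f := fun t (_ : 0 < t) =>
    volume (Metric.ball x t) ^ (-1 + α / (n : ℝ)) * ∫⁻ y in Metric.ball x t,
      ‖(Metric.ball (0 : Rn n) _).indicator (1 : Rn n → ℝ≥0∞) y‖ₑ) (t * 2) ht2)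
  have hsub : Metric.ball (0 : Rn n) t ⊆ Metric.ball x (t * 2) :=
    Metric.ball_subset_ball' (by rw [dist_comm]; linarith [Metric.mem_ball.1 hx])
  have hint : ∫⁻ y in Metric.ball x (t * 2),
      ‖(Metric.ball (0 : Rn n) t).indicator (1 : Rn n → ℝ≥0∞) y‖ₑ =
        volume (Metric.ball (0 : Rn n) t) := by
    simp only [enorm_eq_self]
    rw [lintegral_indicator_one Metric.isOpen_ball.measurableSet,
      Measure.restrict_apply Metric.isOpen_ball.measurableSet, inter_eq_left.2 hsub]
  rw [hint, volume_ball_rpow_neg_one_add x ht2, volume_ball_rpow hn hα.le x ht,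
    ENNReal.ofReal_mul hc.le, ENNReal.ofReal_toReal (by finiteness)]
  have hv := inv_volume_ball_le 0 x t
  rw [mul_comm 2 t] at hv
  have h2 : ((2 ^ n : ℝ≥0) : ℝ≥0∞)⁻¹ =
      (volume (Metric.ball x (t * 2)))⁻¹ * volume (Metric.ball (0 : Rn n) t) := by
    have h3 : (1 : ℝ≥0∞) = (volume (Metric.ball (0 : Rn n) t))⁻¹ *
        volume (Metric.ball (0 : Rn n) t) :=
      (ENNReal.inv_mul_cancel (volume_ball_pos _ ht).ne' (volume_ball_ne_top _ _)).symm
    rw [← mul_one ((2 ^ n : ℝ≥0) : ℝ≥0∞)⁻¹, h3, hv, ← mul_assoc, ← mul_assoc,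
      ENNReal.inv_mul_cancel (by simp) ENNReal.coe_ne_top, one_mul]
  rw [h2]
  exact le_of_eq (by ring)

theorem GClass.le_of_fracMaxBounded (𝕜 : Type*) [RCLike 𝕜] (hn : n ≠ 0) (hα : 0 < α)
    (hβ : 0 < β) (hΦ : IsYoung Φ) (hΨ : ∀ t : ℝ≥0, Ψ t = Φ (t ^ (1 / β)))
    (hη : ∀ t : ℝ, 0 < t → η t = φ t ^ β) (hG : GClass n Φ φ)
    (hb : FracMaxBounded 𝕜 α Φ (fun _ : Rn n => φ) Ψ (fun _ => η)) :
    ∃ C : ℝ, 0 < C ∧ ∀ t : ℝ, 0 < t → t ^ α * φ t ≤ C * φ t ^ β := by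
  obtain ⟨A, hA⟩ := hb
  obtain ⟨D, hD⟩ := hG.exists_orliczMorreyNorm_indicator_le hΦ
  obtain ⟨c, hc, hfrac⟩ := exists_le_fracMax_indicator (n := n) hn hα
  -- Testing yields `c t^α φ(t) ≤ A D η(t)`; the `+ 1` only makes the constant positive.
  refine ⟨(A * D + 1) / c, by positivity, fun t ht => ?_⟩
  set B := Metric.ball (0 : Rn n) t
  have hB : MeasurableSet B := Metric.isOpen_ball.measurableSet
  set f : Rn n → 𝕜 := B.indicator 1
  set χ : Rn n → ℝ≥0∞ := B.indicator 1
  have hfχ : (fun x => ‖f x‖ₑ) = χ := by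
    funext x
    simp only [f, χ, enorm_indicator_eq_indicator_enorm]
    simp [indicator]
  have hφt := hG.pos t ht
  have hηt : 0 < η t := by
    rw [hη t ht]
    exact Real.rpow_pos_of_pos hφt β
  have hφt0 := (ENNReal.ofReal_pos.2 hφt).ne'
  have hηt0 := (ENNReal.ofReal_pos.2 hηt).ne'
  have hDt := hD t ht
  have hf : MemOrliczMorrey Φ (fun _ : Rn n => φ) f := by
    refine memOrliczMorrey_of_lt_top (fun _ => hG.pos)
      (fun x r _ => hΦ.youngInv_ball_ne_zero x r)
      (stronglyMeasurable_one.indicator hB).aestronglyMeasurable ?_ fun x r hr => ?_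
    · rw [← orliczMorreyNorm_enorm, hfχ]
      refine hDt.trans_lt (ENNReal.mul_lt_top ENNReal.coe_lt_top ?_)
      exact ENNReal.inv_lt_top.2 (ENNReal.ofReal_pos.2 hφt)
    · have h1 : ∀ y, ‖f y‖ₑ ≤ 1 := fun y => by
        rw [congrFun hfχ y]
        exact indicator_le_self' (fun _ _ => zero_le) y
      refine (lintegral_mono h1).trans_lt ?_
      rw [setLIntegral_const, one_mul]
      exact (volume_ball_ne_top x r).lt_top
  have hup := (hA f hf).2
  rw [← fracMax_enorm, ← orliczMorreyNorm_enorm f, hfχ] at hup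
  have hY : youngInv Ψ (volume B)⁻¹ = youngInv Φ (volume B)⁻¹ ^ β := youngInv_of_rpow hβ hΨ _
  have hY0 : youngInv Ψ (volume B)⁻¹ ≠ 0 := by
    rw [hY]
    exact (ENNReal.rpow_pos (pos_iff_ne_zero.2 (hΦ.youngInv_ball_ne_zero 0 t))
      (hΦ.youngInv_ball_ne_top 0 ht)).ne'
  have hYT : youngInv Ψ (volume B)⁻¹ ≠ ∞ := by
    rw [hY]
    exact ENNReal.rpow_ne_top_of_nonneg hβ.le (hΦ.youngInv_ball_ne_top 0 ht)
  have hΨm := monotone_of_rpow hβ hΨ hΦ.monotone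
  have hlow : ENNReal.ofReal (c * t ^ α) ≤
      youngInv Ψ (volume B)⁻¹ * orliczNorm Ψ (B.indicator (fracMax α χ)) := by
    refine (le_youngInv_mul_orliczNorm_const hΨm 0 ht hY0 hYT (c * t ^ α).toNNReal).trans
      (mul_le_mul' le_rfl (orliczNorm_mono hΨm fun y => ?_))
    simp only [enorm_eq_self]
    exact indicator_le_indicator' fun hy => hfrac t ht y hy
  have hη0 : ∀ (x : Rn n) r, 0 < r → 0 < (fun _ : Rn n => η) x r := fun _ r hr => by
    simp only [hη r hr]
    exact Real.rpow_pos_of_pos (hG.pos r hr) β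
  have h1 : ENNReal.ofReal (c * t ^ α) ≤
      ENNReal.ofReal (η t) * (A * (D * (ENNReal.ofReal (φ t))⁻¹)) :=
    hlow.trans ((youngInv_mul_orliczNorm_le hη0 _ 0 ht).trans
      (mul_le_mul' le_rfl (hup.trans (mul_le_mul' le_rfl hDt))))
  have h2 : ENNReal.ofReal (c * t ^ α * φ t) ≤ ENNReal.ofReal (η t * (A * D)) := by
    rw [ENNReal.ofReal_mul (by positivity)]
    refine (mul_le_mul' h1 le_rfl).trans_eq ?_
    rw [mul_assoc, mul_assoc, mul_assoc, ENNReal.inv_mul_cancel hφt0 ENNReal.ofReal_ne_top,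
      mul_one, ENNReal.ofReal_mul hηt.le, ENNReal.ofReal_mul A.coe_nonneg,
      ENNReal.ofReal_coe_nnreal, ENNReal.ofReal_coe_nnreal]
  have h3 := (ENNReal.ofReal_le_ofReal_iff (by positivity)).1 h2
  rw [← hη t ht, div_mul_eq_mul_div, le_div_iff₀ hc]
  nlinarith

end Necessity

end OrliczMorrey

/-! ### Assembly of the three statements. -/

theorem mainTheorem1 (𝕜 : Type*) [RCLike 𝕜] (n : ℕ) (α β : ℝ) (hα : 0 < α) (hαn : α < n)
    (hβ : 0 < β) (hβ1 : β < 1)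
    (Φ : ℝ≥0 → ℝ≥0∞) (hΦ : OrliczMorrey.IsYoung Φ) (hΦ' : OrliczMorrey.DeltaPrime Φ)
    (φ : ℝ → ℝ) (hφ : OrliczMorrey.OmegaClass Φ (fun _ : OrliczMorrey.Rn n => φ))
    (Ψ : ℝ≥0 → ℝ≥0∞) (hΨ : ∀ t : ℝ≥0, Ψ t = Φ (t ^ (1 / β)))
    (η : ℝ → ℝ) (hη : ∀ t : ℝ, 0 < t → η t = φ t ^ β) :
    (OrliczMorrey.Nabla2 Φ →
      OrliczMorrey.MaximalCondition Φ (fun _ : OrliczMorrey.Rn n => φ) →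
      (∃ C : ℝ, 0 < C ∧ ∀ t : ℝ, 0 < t →
        ENNReal.ofReal (t ^ α * φ t) + (⨆ (r : ℝ) (_ : t < r), ENNReal.ofReal (r ^ α * φ r)) ≤
          ENNReal.ofReal (C * φ t ^ β)) →
      OrliczMorrey.FracMaxBounded 𝕜 α Φ (fun _ : OrliczMorrey.Rn n => φ) Ψ (fun _ => η)) ∧
    (OrliczMorrey.GClass n Φ φ →
      OrliczMorrey.FracMaxBounded 𝕜 α Φ (fun _ : OrliczMorrey.Rn n => φ) Ψ (fun _ => η) →
      ∃ C : ℝ, 0 < C ∧ ∀ t : ℝ, 0 < t → t ^ α * φ t ≤ C * φ t ^ β) ∧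
    (OrliczMorrey.Nabla2 Φ → OrliczMorrey.GClass n Φ φ →
      ((∃ C : ℝ, 0 < C ∧ ∀ t : ℝ, 0 < t → t ^ α * φ t ≤ C * φ t ^ β) ↔
        OrliczMorrey.FracMaxBounded 𝕜 α Φ (fun _ : OrliczMorrey.Rn n => φ) Ψ (fun _ => η))) := by
  have hn : n ≠ 0 := by
    rintro rfl
    rw [Nat.cast_zero] at hαn
    exact hα.not_gt hαn
  refine ⟨fun h2 hM ⟨C, _, hC⟩ => ?_, fun hG hb =>
    hG.le_of_fracMaxBounded 𝕜 hn hα hβ hΦ hΨ hη hb, fun h2 hG => ⟨fun ⟨C, _, hC⟩ => ?_, fun hb =>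
    hG.le_of_fracMaxBounded 𝕜 hn hα hβ hΦ hΨ hη hb⟩⟩
  · have hpos : ∀ t, 0 < t → 0 < φ t := fun t ht => hφ.pos 0 t ht
    refine OrliczMorrey.fracMaxBounded_of_le 𝕜 hn hα hβ hβ1 hΦ h2 hpos hΨ hη hM (C := C)
      fun t ht => ?_
    -- The supremum is dropped from the sum. Comparing `ENNReal.ofReal` values leaves the
    -- alternative that the left side is nonpositive, excluded by positivity of `φ`.
    refine (ENNReal.ofReal_le_ofReal_iff' .. |>.1 (le_self_add.trans (hC t ht))).resolve_right ?_
    exact (mul_pos (Real.rpow_pos_of_pos ht α) (hpos t ht)).not_ge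
  · exact OrliczMorrey.fracMaxBounded_of_le 𝕜 hn hα hβ hβ1 hΦ h2 hG.pos hΨ hη
      (hG.maximalCondition hΦ) hC
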